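/- Let $\Delta\in\mathbb{Z}$ be a non-square integer with $\Delta\equiv 0$ or $1 \pmod 4$. Let $\mathrm{Cl}(\Delta)$ be the set of $\mathrm{PSL}_2(\mathbb{Z})$-classes (under change of variables) of primitive integral binary quadratic forms $Q=lx^2+mxy+ry^2$ of discriminant $m^2-4lr=\Delta$ (when $\Delta<0$, positive and negative definite forms are both included). It is an abelian group under Gauss composition: if two classes are represented by forms with coprime first coefficients $l_a,l_b$ and the same middle coefficient $m$, their product is the class of the form of discriminant $\Delta$ with first coefficient $l_al_b$ and middle coefficient $m$. The neutral element is the class of the principal form $x^2+\epsilon xy+\tfrac14(\epsilon-\Delta)y^2$, where $\epsilon\in\{0,1\}$ and $\Delta\equiv\epsilon \pmod 4$. Two classes are called $\mathbb{Q}$-equivalent if their representatives are equivalent under $\mathrm{PSL}_2(\mathbb{Q})$; they belong to the same genus if their representatives are equivalent under $\mathrm{SL}_2(\mathbb{R})$ and under $\mathrm{SL}_2(\mathbb{Z}_p)$ for every prime $p$. The principal genus is the set of classes in the genus of the principal form. The discriminant $\Delta$ is fundamental if either $\Delta\equiv 1\pmod 4$ and $\Delta$ is square-free, or $4\mid\Delta$,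 $\Delta/4\not\equiv 1\pmod 4$ and $\Delta/4$ is square-free. Then: 1. The principal genus is the subgroup of squares $\mathrm{Cl}(\Delta)^2$. 2. The classes that are $\mathbb{Q}$-equivalent to the principal form form a subgroup of $\mathrm{Cl}(\Delta)$, and this subgroup contains $\mathrm{Cl}(\Delta)^2$. 3. Any two classes of $\mathrm{Cl}(\Delta)$ that belong to the same genus are $\mathbb{Q}$-equivalent. 4. If $\Delta$ is fundamental, then any two $\mathbb{Q}$-equivalent classes of $\mathrm{Cl}(\Delta)$ belong to the same genus. The hypothesis in 4 cannot simply be dropped: there is a non-square, non-fundamental discriminant $\Delta$ and two $\mathbb{Q}$-equivalent classes of $\mathrm{Cl}(\Delta)$ that do not belong to the same genus. -/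

import Mathlib

/-- The binary quadratic form `l x² + m x y + r y²` with coefficients in `R`. -/
@[ext]
structure BinForm (R : Type*) where
  l : R
  m : R
  r : R

namespace BinForm

variable {R S : Type*} [CommRing R] [CommRing S]

/-- The value of the form at `(x, y)`. -/
def eval (Q : BinForm R) (x y : R) : R := Q.l * x ^ 2 + Q.m * x * y + Q.r * y ^ 2

/-- The discriminant `m² - 4 l r`. -/
def disc (Q : BinForm R) : R := Q.m ^ 2 - 4 * Q.l * Q.r

/-- Extension of scalars. -/
def map (φ : R →+* S) (Q : BinForm R) : BinForm S := ⟨φ Q.l, φ Q.m, φ Q.r⟩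

/-- The linear change of variables `(x, y) ↦ M (x, y)`; see `eval_comp`. -/
def comp (Q : BinForm R) (M : Matrix (Fin 2) (Fin 2) R) : BinForm R :=
  ⟨Q.eval (M 0 0) (M 1 0),
   2 * Q.l * M 0 0 * M 0 1 + Q.m * (M 0 0 * M 1 1 + M 0 1 * M 1 0) + 2 * Q.r * M 1 0 * M 1 1,
   Q.eval (M 0 1) (M 1 1)⟩

theorem eval_comp (Q : BinForm R) (M : Matrix (Fin 2) (Fin 2) R) (x y : R) :
    (Q.comp M).eval x y = Q.eval (M 0 0 * x + M 0 1 * y) (M 1 0 * x + M 1 1 * y) := by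
  simp only [eval, comp]; ring

/-- Two forms over `R` are equivalent when they are exchanged by a change of variables in
`SL₂(R)` (as `-1` acts trivially, this is the same as equivalence under `PSL₂(R)`). -/
def SLEquiv (Q Q' : BinForm R) : Prop :=
  ∃ M : Matrix.SpecialLinearGroup (Fin 2) R, Q' = Q.comp M.1

/-- An integral form is primitive when its coefficients have no common divisor but units. -/
def Primitive (Q : BinForm ℤ) : Prop :=
  ∀ d : ℤ, d ∣ Q.l → d ∣ Q.m → d ∣ Q.r → IsUnit d

theorem comp_one (Q : BinForm R) : Q.comp 1 = Q := by
  ext <;> simp [comp, eval]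

theorem comp_mul (Q : BinForm R) (M N : Matrix (Fin 2) (Fin 2) R) :
    Q.comp (M * N) = (Q.comp M).comp N := by
  ext <;> simp only [comp, eval, Matrix.mul_apply, Fin.sum_univ_two] <;> ring

theorem map_comp (φ : R →+* S) (Q : BinForm R) (M : Matrix (Fin 2) (Fin 2) R) :
    (Q.comp M).map φ = (Q.map φ).comp (M.map φ) := by
  ext <;> simp [comp, eval, map, map_ofNat]

theorem disc_comp (Q : BinForm R) (M : Matrix (Fin 2) (Fin 2) R) :
    (Q.comp M).disc = M.det ^ 2 * Q.disc := by
  simp only [disc, comp, eval, Matrix.det_fin_two]; ring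

theorem SLEquiv.refl (Q : BinForm R) : SLEquiv Q Q := ⟨1, by simp [comp_one]⟩

theorem SLEquiv.symm {Q Q' : BinForm R} : SLEquiv Q Q' → SLEquiv Q' Q := by
  rintro ⟨M, rfl⟩
  refine ⟨M⁻¹, ?_⟩
  rw [← comp_mul, ← Matrix.SpecialLinearGroup.coe_mul, mul_inv_cancel]
  simp [comp_one]

theorem SLEquiv.trans {Q Q' Q'' : BinForm R} :
    SLEquiv Q Q' → SLEquiv Q' Q'' → SLEquiv Q Q'' := by
  rintro ⟨M, rfl⟩ ⟨N, rfl⟩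
  exact ⟨M * N, by rw [Matrix.SpecialLinearGroup.coe_mul, comp_mul]⟩

theorem SLEquiv.map (φ : R →+* S) {Q Q' : BinForm R} :
    SLEquiv Q Q' → SLEquiv (Q.map φ) (Q'.map φ) := by
  rintro ⟨M, rfl⟩
  exact ⟨M.map φ, by rw [map_comp]; rfl⟩

theorem SLEquiv.disc_eq {Q Q' : BinForm R} : SLEquiv Q Q' → Q'.disc = Q.disc := by
  rintro ⟨M, rfl⟩
  rw [disc_comp, M.2]; ring

theorem SLEquiv.primitive {Q Q' : BinForm ℤ} (h : SLEquiv Q Q') (hQ : Q.Primitive) :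
    Q'.Primitive := by
  obtain ⟨M, rfl⟩ := h.symm
  intro d hl hm hr
  apply hQ d
  · simp only [comp, eval]
    exact dvd_add (dvd_add (hl.mul_right _) ((hm.mul_right _).mul_right _)) (hr.mul_right _)
  · simp only [comp]
    exact dvd_add (dvd_add (((hl.mul_left _).mul_right _).mul_right _) (hm.mul_right _))
      (((hr.mul_left _).mul_right _).mul_right _)
  · simp only [comp, eval]
    exact dvd_add (dvd_add (hl.mul_right _) ((hm.mul_right _).mul_right _)) (hr.mul_right _)

theorem slEquiv_of_entries (Q : BinForm R) (p q r s : R) (h : p * s - q * r = 1) :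
    SLEquiv Q (Q.comp !![p, q; r, s]) :=
  ⟨⟨!![p, q; r, s], by rw [Matrix.det_fin_two_of, h]⟩, rfl⟩

end BinForm

/-- `Δ` is the discriminant of an integral binary quadratic form and is not a square. -/
class NonsquareDisc (Δ : ℤ) : Prop where
  not_isSquare : ¬ IsSquare Δ
  mod_four : Δ % 4 = 0 ∨ Δ % 4 = 1

/-- Fundamental discriminants, i.e. the discriminants of the quadratic extensions of `ℚ`. -/
def IsFundamentalDisc (Δ : ℤ) : Prop :=
  ¬ IsSquare Δ ∧
    ((Δ % 4 = 1 ∧ Squarefree Δ) ∨ (Δ % 4 = 0 ∧ (Δ / 4) % 4 ≠ 1 ∧ Squarefree (Δ / 4)))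

/-- Primitive integral binary quadratic forms of discriminant `Δ`. -/
abbrev PrimForm (Δ : ℤ) : Type := {Q : BinForm ℤ // Q.disc = Δ ∧ Q.Primitive}

/-- `SL₂(ℤ)`-equivalence of primitive forms. -/
def PrimForm.setoid (Δ : ℤ) : Setoid (PrimForm Δ) where
  r Q Q' := BinForm.SLEquiv Q.1 Q'.1
  iseqv := ⟨fun Q => .refl Q.1, fun h => h.symm, fun h h' => h.trans h'⟩

/-- The set `Cl(Δ)` of `SL₂(ℤ)`-classes of primitive integral forms of discriminant `Δ`. -/
def Cl (Δ : ℤ) : Type := Quotient (PrimForm.setoid Δ)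

namespace Cl

variable {Δ : ℤ}

/-- The class of a form. -/
def mk (Q : PrimForm Δ) : Cl Δ := Quotient.mk _ Q

theorem mk_eq_mk {Q Q' : PrimForm Δ} : mk Q = mk Q' ↔ BinForm.SLEquiv Q.1 Q'.1 :=
  Quotient.eq

theorem exists_mk (A : Cl Δ) : ∃ Q, mk Q = A := Quotient.exists_rep A

/-- Two classes are `R`-equivalent when forms representing them become equivalent under
`SL₂(R)` after extension of scalars from `ℤ` to `R`. -/
def EquivOver (R : Type*) [CommRing R] (A B : Cl Δ) : Prop :=
  Quotient.liftOn₂ A B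
    (fun Q Q' => BinForm.SLEquiv (Q.1.map (Int.castRingHom R)) (Q'.1.map (Int.castRingHom R)))
    (fun _ _ _ _ h h' => propext
      ⟨fun k => ((h.map _).symm.trans k).trans (h'.map _),
       fun k => ((h.map _).trans k).trans (h'.map _).symm⟩)

/-- `ℚ`-equivalence of classes. -/
def QEquiv (A B : Cl Δ) : Prop := EquivOver ℚ A B

/-- Two classes belong to the same genus when they are equivalent over `ℝ` and over `ℤ_p` for
all primes `p`. -/
def SameGenus (A B : Cl Δ) : Prop :=
  EquivOver ℝ A B ∧ ∀ (p : ℕ) [Fact p.Prime], EquivOver ℤ_[p] A B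

/-- The form `Qc` is the composition of `Qa` and `Qb`: the first coefficients of `Qa`, `Qb` are
coprime, their middle coefficients are equal, and `Qc` (whose discriminant is also `Δ`) has first
coefficient the product of those of `Qa` and `Qb`, and the same middle coefficient. -/
def IsComposition (Qa Qb Qc : PrimForm Δ) : Prop :=
  IsCoprime Qa.1.l Qb.1.l ∧ Qa.1.m = Qb.1.m ∧ Qc.1.l = Qa.1.l * Qb.1.l ∧ Qc.1.m = Qa.1.m

/-! The following facts show that the composition is defined for all pairs of classes, that it
does not depend on the representatives, and that it satisfies the group axioms. -/

theorem isCoprime_of_primes {a b : ℤ}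
    (h : ∀ p : ℕ, p.Prime → (p : ℤ) ∣ a → (p : ℤ) ∣ b → False) : IsCoprime a b := by
  rw [Int.isCoprime_iff_gcd_eq_one]
  by_contra hne
  obtain ⟨p, hp, hd⟩ := Nat.exists_prime_and_dvd hne
  have hd' : (p : ℤ) ∣ (Int.gcd a b : ℤ) := by exact_mod_cast hd
  exact h p hp (hd'.trans (Int.gcd_dvd_left ..)) (hd'.trans (Int.gcd_dvd_right ..))

theorem prime_dvd_prod {s : Finset ℕ} (hs : ∀ q ∈ s, q.Prime) {p : ℕ} (hp : p.Prime) :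
    (p : ℤ) ∣ ∏ q ∈ s, (q : ℤ) ↔ p ∈ s := by
  rw [← Nat.cast_prod, Int.natCast_dvd_natCast, hp.prime.dvd_finsetProd_iff]
  constructor
  · rintro ⟨q, hq, hpq⟩
    rwa [(Nat.prime_dvd_prime_iff_eq hp (hs q hq)).1 hpq]
  · exact fun h => ⟨p, h, dvd_rfl⟩

theorem exists_separating (n : ℤ) (hn : n ≠ 0) (P : ℕ → Prop) :
    ∃ x : ℤ, (∀ p : ℕ, p.Prime → (p : ℤ) ∣ n → ((p : ℤ) ∣ x ↔ P p)) ∧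
      (∀ p : ℕ, p.Prime → (p : ℤ) ∣ x → (p : ℤ) ∣ n ∧ P p) := by
  classical
  have hs : ∀ q ∈ n.natAbs.primeFactors.filter P, q.Prime := fun q hq =>
    Nat.prime_of_mem_primeFactors (Finset.mem_filter.1 hq).1
  have key : ∀ p : ℕ, p.Prime →
      ((p : ℤ) ∣ ∏ q ∈ n.natAbs.primeFactors.filter P, (q : ℤ) ↔ (p : ℤ) ∣ n ∧ P p) := by
    intro p hp
    rw [prime_dvd_prod hs hp, Finset.mem_filter, Nat.mem_primeFactors_of_ne_zero
      (Int.natAbs_ne_zero.2 hn), Int.natCast_dvd]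
    simp [hp]
  exact ⟨_, fun p hp hpn => by rw [key p hp]; simp [hpn], fun p hp h => (key p hp).1 h⟩

theorem not_all_dvd {Q : BinForm ℤ} (hQ : Q.Primitive) {p : ℕ} (hp : p.Prime)
    (h1 : (p : ℤ) ∣ Q.l) (h2 : (p : ℤ) ∣ Q.m) (h3 : (p : ℤ) ∣ Q.r) : False :=
  (Nat.prime_iff_prime_int.1 hp).not_isUnit (hQ p h1 h2 h3)

theorem primitive_of_primes {Q : BinForm ℤ}
    (h : ∀ p : ℤ, Prime p → p ∣ Q.l → p ∣ Q.m → p ∣ Q.r → False) : Q.Primitive := by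
  intro d h1 h2 h3
  by_contra hd
  obtain ⟨p, hp, hpd⟩ := Int.exists_prime_and_dvd (n := d) (fun h => hd (Int.isUnit_iff_natAbs_eq.2 h))
  exact h p hp (hpd.trans h1) (hpd.trans h2) (hpd.trans h3)

theorem exists_coprime_value {Q : BinForm ℤ} (hQ : Q.Primitive) {n : ℤ} (hn : n ≠ 0) :
    ∃ x y : ℤ, IsCoprime x y ∧ IsCoprime (Q.eval x y) n := by
  obtain ⟨x, hx, hx'⟩ := exists_separating n hn (fun p => (p : ℤ) ∣ Q.l ∧ ¬ (p : ℤ) ∣ Q.r)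
  obtain ⟨y, hy, hy'⟩ := exists_separating n hn (fun p => ¬ (p : ℤ) ∣ Q.l)
  refine ⟨x, y, isCoprime_of_primes fun p hp h1 h2 => (hy' p hp h2).2 (hx' p hp h1).2.1,
    isCoprime_of_primes fun p hp h1 h2 => ?_⟩
  have hpi : Prime (p : ℤ) := Nat.prime_iff_prime_int.1 hp
  have hx1 := hx p hp h2
  have hy1 := hy p hp h2
  unfold BinForm.eval at h1
  by_cases hl : (p : ℤ) ∣ Q.l
  · have hyn : ¬ (p : ℤ) ∣ y := by simp [hy1, hl]
    have h3 : (p : ℤ) ∣ Q.m * x * y + Q.r * y ^ 2 := by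
      have := dvd_sub h1 (hl.mul_right (x ^ 2))
      ring_nf at this ⊢; exact this
    by_cases hr : (p : ℤ) ∣ Q.r
    · have hxn : ¬ (p : ℤ) ∣ x := by simp [hx1, hr]
      have h4 : (p : ℤ) ∣ Q.m * x * y := (dvd_add_left (hr.mul_right (y ^ 2))).1 h3
      rcases hpi.dvd_or_dvd h4 with h5 | h5
      · rcases hpi.dvd_or_dvd h5 with h6 | h6
        · exact not_all_dvd hQ hp hl h6 hr
        · exact hxn h6
      · exact hyn h5
    · have hxd : (p : ℤ) ∣ x := hx1.2 ⟨hl, hr⟩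
      have h4 : (p : ℤ) ∣ Q.r * y ^ 2 :=
        (dvd_add_right ((hxd.mul_left Q.m).mul_right y)).1 h3
      rcases hpi.dvd_or_dvd h4 with h5 | h5
      · exact hr h5
      · exact hyn (hpi.dvd_of_dvd_pow h5)
  · have hyd : (p : ℤ) ∣ y := hy1.2 hl
    have hxn : ¬ (p : ℤ) ∣ x := by simp [hx1, hl]
    have h3 : (p : ℤ) ∣ Q.l * x ^ 2 := by
      have := dvd_sub h1 (dvd_add (hyd.mul_left (Q.m * x)) (hyd.mul_left (Q.r * y)))
      ring_nf at this ⊢; exact this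
    rcases hpi.dvd_or_dvd h3 with h5 | h5
    · exact hl h5
    · exact hxn (hpi.dvd_of_dvd_pow h5)

/-- A form equivalent to a primitive one, as an element of `PrimForm Δ`. -/
def move (Q : PrimForm Δ) (p q r s : ℤ) (h : p * s - q * r = 1) : PrimForm Δ :=
  ⟨Q.1.comp !![p, q; r, s],
   by rw [(Q.1.slEquiv_of_entries p q r s h).disc_eq, Q.2.1],
   (Q.1.slEquiv_of_entries p q r s h).primitive Q.2.2⟩

theorem mk_move (Q : PrimForm Δ) (p q r s : ℤ) (h : p * s - q * r = 1) :
    mk (move Q p q r s h) = mk Q :=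
  (mk_eq_mk.2 (Q.1.slEquiv_of_entries p q r s h)).symm

/-- The change of variables `x ↦ x + t y`. -/
theorem exists_shift (Q : PrimForm Δ) (t : ℤ) : ∃ Q' : PrimForm Δ, mk Q' = mk Q ∧
    Q'.1.l = Q.1.l ∧ Q'.1.m = Q.1.m + 2 * Q.1.l * t ∧
    Q'.1.r = Q.1.l * t ^ 2 + Q.1.m * t + Q.1.r :=
  ⟨move Q 1 t 0 1 (by ring), mk_move .., by simp [move, BinForm.comp, BinForm.eval],
    by simp [move, BinForm.comp]; ring, by simp [move, BinForm.comp, BinForm.eval]⟩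

theorem exists_coprime_rep (A : Cl Δ) {n : ℤ} (hn : n ≠ 0) :
    ∃ Q : PrimForm Δ, mk Q = A ∧ IsCoprime Q.1.l n := by
  obtain ⟨Q, rfl⟩ := exists_mk A
  obtain ⟨x, y, ⟨u, v, h⟩, hxy⟩ := exists_coprime_value Q.2.2 hn
  exact ⟨move Q x (-v) y u (by linear_combination h), mk_move .., by
    simpa [move, BinForm.comp] using hxy⟩

theorem disc_eq (Q : PrimForm Δ) : Q.1.m ^ 2 - 4 * Q.1.l * Q.1.r = Δ := Q.2.1

theorem exists_even (Q Q' : PrimForm Δ) : ∃ k : ℤ, Q'.1.m = Q.1.m + 2 * k := by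
  have h := disc_eq Q
  have h' := disc_eq Q'
  have : (2 : ℤ) ∣ (Q'.1.m - Q.1.m) ^ 2 :=
    ⟨2 * (Q'.1.l * Q'.1.r - Q.1.l * Q.1.r) + Q.1.m * (Q.1.m - Q'.1.m), by
      linear_combination h' - h⟩
  obtain ⟨k, hk⟩ := Int.prime_two.dvd_of_dvd_pow this
  exact ⟨k, by linear_combination hk⟩

/-- Forms with coprime first coefficients may be given the same middle coefficient. -/
theorem exists_align (Qa Qb : PrimForm Δ) (h : IsCoprime Qa.1.l Qb.1.l) :
    ∃ s t : ℤ, Qa.1.m + 2 * Qa.1.l * s = Qb.1.m + 2 * Qb.1.l * t := by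
  obtain ⟨k, hk⟩ := exists_even Qa Qb
  obtain ⟨u, v, huv⟩ := h
  exact ⟨u * k, - (v * k), by rw [hk]; linear_combination 2 * k * huv⟩

/-- The opposite form `l x² - m x y + r y²`. -/
def opp (Q : PrimForm Δ) : PrimForm Δ :=
  ⟨⟨Q.1.l, -Q.1.m, Q.1.r⟩, by
    have := disc_eq Q; simp only [BinForm.disc]; linear_combination this,
    fun d h1 h2 h3 => Q.2.2 d h1 ((dvd_neg).1 h2) h3⟩

/-- The inverse of the class of a form is the class of the opposite form. -/
instance : Inv (Cl Δ) := ⟨fun A => Quotient.map' (s₁ := PrimForm.setoid Δ)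
  (s₂ := PrimForm.setoid Δ) opp (fun Q Q' h => by
    obtain ⟨⟨M, hM⟩, h⟩ := h
    rw [Matrix.det_fin_two] at hM
    refine ⟨⟨!![M 0 0, -M 0 1; -M 1 0, M 1 1], by
      rw [Matrix.det_fin_two_of]; linear_combination hM⟩, ?_⟩
    have hl := congrArg BinForm.l h
    have hm := congrArg BinForm.m h
    have hr := congrArg BinForm.r h
    simp only [BinForm.comp, BinForm.eval] at hl hm hr
    ext
    · simp [opp, BinForm.comp, BinForm.eval, hl]
    · simp [opp, BinForm.comp, hm]; ring
    · simp [opp, BinForm.comp, BinForm.eval, hr]) A⟩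

theorem inv_mk (Q : PrimForm Δ) : (mk Q)⁻¹ = mk (opp Q) := rfl

theorem mk_swap (Q : PrimForm Δ) : ∃ Q' : PrimForm Δ, mk Q' = mk Q ∧
    Q'.1.l = Q.1.r ∧ Q'.1.m = -Q.1.m ∧ Q'.1.r = Q.1.l :=
  ⟨move Q 0 (-1) 1 0 (by ring), mk_move .., by simp [move, BinForm.comp, BinForm.eval],
    by simp [move, BinForm.comp], by simp [move, BinForm.comp, BinForm.eval]⟩

section

variable [NonsquareDisc Δ]

theorem l_ne_zero (Q : PrimForm Δ) : Q.1.l ≠ 0 := fun h =>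
  NonsquareDisc.not_isSquare (Δ := Δ) ⟨Q.1.m, by have := disc_eq Q; rw [h] at this; linear_combination -this⟩

theorem exists_isComposition (Qa Qb : PrimForm Δ) (h : IsCoprime Qa.1.l Qb.1.l)
    (hm : Qa.1.m = Qb.1.m) : ∃ Qc, IsComposition Qa Qb Qc := by
  have ha := disc_eq Qa
  have hb := disc_eq Qb
  have hlr : Qa.1.l * Qa.1.r = Qb.1.l * Qb.1.r := by
    have : 4 * (Qa.1.l * Qa.1.r) = 4 * (Qb.1.l * Qb.1.r) := by
      rw [hm] at ha; linear_combination hb - ha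
    linarith
  obtain ⟨c, hc⟩ : Qb.1.l ∣ Qa.1.r := h.symm.dvd_of_dvd_mul_left ⟨Qb.1.r, hlr⟩
  have hc' : Qb.1.r = Qa.1.l * c := by
    apply mul_left_cancel₀ (l_ne_zero Qb)
    rw [← hlr, hc]; ring
  refine ⟨⟨⟨Qa.1.l * Qb.1.l, Qa.1.m, c⟩, ?_, ?_⟩, h, hm, rfl, rfl⟩
  · rw [hc] at ha; simp only [BinForm.disc]; linear_combination ha
  · refine primitive_of_primes fun p hp h1 h2 h3 => ?_
    simp only at h1 h2 h3
    rcases hp.dvd_or_dvd h1 with h4 | h4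
    · exact hp.not_isUnit (Qa.2.2 p h4 h2 (hc ▸ h3.mul_left _))
    · exact hp.not_isUnit (Qb.2.2 p h4 (hm ▸ h2) (hc' ▸ h3.mul_left _))

theorem exists_composition (A B : Cl Δ) : ∃ C : Cl Δ, ∃ Qa Qb Qc : PrimForm Δ,
    mk Qa = A ∧ mk Qb = B ∧ mk Qc = C ∧ IsComposition Qa Qb Qc := by
  obtain ⟨Qa, rfl⟩ := exists_mk A
  obtain ⟨Qb, rfl, hab⟩ := exists_coprime_rep B (l_ne_zero Qa)
  obtain ⟨s, t, hst⟩ := exists_align Qa Qb hab.symm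
  obtain ⟨Qa', ha, hal, ham, -⟩ := exists_shift Qa s
  obtain ⟨Qb', hb, hbl, hbm, -⟩ := exists_shift Qb t
  obtain ⟨Qc, hc⟩ := exists_isComposition Qa' Qb' (by rw [hal, hbl]; exact hab.symm)
    (by rw [ham, hbm, hst])
  exact ⟨mk Qc, Qa', Qb', Qc, ha, hb, rfl, hc⟩

end

/-- The algebra `ℚ[√Δ]`. -/
abbrev K (Δ : ℤ) : Type := QuadraticAlgebra ℚ (Δ : ℚ) 0

/-- The root `(-m + √Δ) / (2 l)` of a form. -/
def root (Q : PrimForm Δ) : K Δ := ⟨-Q.1.m / (2 * Q.1.l), 1 / (2 * Q.1.l)⟩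

/-- Membership in the lattice `ℤ + ℤ τ`, where `τ` is the root of the form. -/
def InLattice (Q : PrimForm Δ) (z : K Δ) : Prop := ∃ x y : ℤ, z = (x : K Δ) + (y : K Δ) * root Q

/-- The lattice of `Q` is mapped into that of `Q'` by a homothety of the appropriate norm. -/
def Homothetic (Q Q' : PrimForm Δ) : Prop := ∃ z : K Δ,
  (z.re ^ 2 - Δ * z.im ^ 2) * Q'.1.l = Q.1.l ∧ InLattice Q' z ∧ InLattice Q' (z * root Q)

theorem InLattice.add {Q : PrimForm Δ} {z w : K Δ} (hz : InLattice Q z) (hw : InLattice Q w) :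
    InLattice Q (z + w) := by
  obtain ⟨x, y, rfl⟩ := hz
  obtain ⟨x', y', rfl⟩ := hw
  exact ⟨x + x', y + y', by push_cast; ring⟩

theorem InLattice.int_mul {Q : PrimForm Δ} {z : K Δ} (n : ℤ) (hz : InLattice Q z) :
    InLattice Q ((n : K Δ) * z) := by
  obtain ⟨x, y, rfl⟩ := hz
  exact ⟨n * x, n * y, by push_cast; ring⟩

theorem disc_eq' (Q : PrimForm Δ) : (Q.1.m : ℚ) ^ 2 - 4 * Q.1.l * Q.1.r = Δ := by
  exact_mod_cast disc_eq Q

section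

variable [NonsquareDisc Δ]

theorem l_ne_zero' (Q : PrimForm Δ) : (Q.1.l : ℚ) ≠ 0 := by exact_mod_cast l_ne_zero Q

theorem homothetic_of_slEquiv {Q Q' : PrimForm Δ} (h : BinForm.SLEquiv Q.1 Q'.1) :
    Homothetic Q Q' := by
  obtain ⟨⟨M, hM⟩, h⟩ := h.symm
  have hl : Q.1.l = (Q'.1.comp M).l := by rw [h]
  have hm : Q.1.m = (Q'.1.comp M).m := by rw [h]
  simp only [BinForm.comp, BinForm.eval] at hl hm
  rw [Matrix.det_fin_two] at hM
  generalize M 0 0 = p, M 0 1 = q, M 1 0 = r, M 1 1 = s at *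
  have hlQ : (Q.1.l : ℚ) = _ := congrArg Int.cast hl
  have hmQ : (Q.1.m : ℚ) = _ := congrArg Int.cast hm
  have hMQ : (p * s - q * r : ℚ) = 1 := by exact_mod_cast hM
  push_cast at hlQ hmQ
  have h0 := l_ne_zero' Q
  have h0' := l_ne_zero' Q'
  have hd := disc_eq' Q'
  refine ⟨(p : K Δ) + ((-r : ℤ) : K Δ) * root Q', ?_, ⟨p, -r, rfl⟩, ⟨-q, s, ?_⟩⟩
  · simp only [root, QuadraticAlgebra.re_add, QuadraticAlgebra.im_add, QuadraticAlgebra.re_mul,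
      QuadraticAlgebra.im_mul, QuadraticAlgebra.re_intCast, QuadraticAlgebra.im_intCast]
    rw [hlQ]
    field_simp
    push_cast
    linear_combination (r : ℚ) ^ 2 * hd
  · ext
    · simp only [root, QuadraticAlgebra.re_add, QuadraticAlgebra.im_add, QuadraticAlgebra.re_mul,
        QuadraticAlgebra.im_mul, QuadraticAlgebra.re_intCast, QuadraticAlgebra.im_intCast]
      field_simp
      push_cast
      rw [hlQ, hmQ, ← hd]
      linear_combination (r : ℚ) *
        ((Q'.1.m : ℚ) ^ 2 - 4 * Q'.1.l * Q'.1.r) * hMQ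
    · simp only [root, QuadraticAlgebra.re_add, QuadraticAlgebra.im_add, QuadraticAlgebra.re_mul,
        QuadraticAlgebra.im_mul, QuadraticAlgebra.re_intCast, QuadraticAlgebra.im_intCast]
      field_simp
      push_cast
      rw [hlQ, hmQ]
      linear_combination -(2 * (Q'.1.l : ℚ) * p + r * Q'.1.m) * hMQ

theorem eq_of_l_m {Q Q' : BinForm ℤ} (hd : Q.disc = Q'.disc) (hl : Q.l = Q'.l)
    (hm : Q.m = Q'.m) (h0 : Q.l ≠ 0) : Q = Q' := by
  ext
  · exact hl
  · exact hm
  · simp only [BinForm.disc, ← hl, ← hm] at hd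
    have : (4 * Q.l) * Q.r = (4 * Q.l) * Q'.r := by linear_combination -hd
    exact mul_left_cancel₀ (by simpa using h0) this

theorem slEquiv_of_homothetic {Q Q' : PrimForm Δ} (h : Homothetic Q Q') :
    BinForm.SLEquiv Q.1 Q'.1 := by
  obtain ⟨z, hz, ⟨s, r, h1⟩, ⟨q, p, h2⟩⟩ := h
  have h0 := l_ne_zero' Q
  have h0' := l_ne_zero' Q'
  have hd := disc_eq' Q'
  have e2 := congrArg QuadraticAlgebra.im h2
  have e3 := congrArg QuadraticAlgebra.re h2
  rw [h1] at hz e2 e3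
  simp only [root, QuadraticAlgebra.re_add, QuadraticAlgebra.im_add, QuadraticAlgebra.re_mul,
    QuadraticAlgebra.im_mul, QuadraticAlgebra.re_intCast, QuadraticAlgebra.im_intCast] at hz e2 e3
  have E1 : (Q.1.l : ℚ) = Q'.1.l * s ^ 2 - Q'.1.m * s * r + Q'.1.r * r ^ 2 := by
    rw [← hz]
    field_simp
    linear_combination (r : ℚ) ^ 2 * hd
  have E2 : 2 * (Q'.1.l : ℚ) * s - r * Q'.1.m - r * Q.1.m = 2 * p * Q.1.l := by
    field_simp at e2
    linear_combination e2
  have E3 : -(Q.1.m : ℚ) * (2 * Q'.1.l * s - r * Q'.1.m) + Δ * r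
      = 4 * q * Q.1.l * Q'.1.l - 2 * p * Q'.1.m * Q.1.l := by
    field_simp at e3
    linear_combination e3
  have hdet : (s * p - -q * -r : ℚ) = 1 := by
    have : (4 * Q.1.l * Q'.1.l : ℚ) * (s * p - -q * -r) = (4 * Q.1.l * Q'.1.l : ℚ) * 1 := by
      linear_combination -(2 * Q'.1.l * s - r * Q'.1.m : ℚ) * E2 + (r : ℚ) * E3
        + (r : ℚ) ^ 2 * hd - 4 * (Q'.1.l : ℚ) * E1
    exact mul_left_cancel₀ (by positivity) this
  have hm : (Q.1.m : ℚ) = 2 * Q'.1.l * s * (-q) + Q'.1.m * (s * p + -q * -r)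
      + 2 * Q'.1.r * (-r) * p := by
    have : (4 * Q.1.l * Q'.1.l : ℚ) * Q.1.m = (4 * Q.1.l * Q'.1.l : ℚ) *
      (2 * Q'.1.l * s * (-q) + Q'.1.m * (s * p + -q * -r) + 2 * Q'.1.r * (-r) * p) := by
      linear_combination (Q'.1.m * r - 2 * Q'.1.l * s : ℚ) * E3
        + (Q'.1.m ^ 2 - 4 * Q'.1.l * Q'.1.r : ℚ) * r * E2 + 4 * (Q'.1.l : ℚ) * Q.1.m * E1
        - (2 * Q'.1.l * s - r * Q'.1.m : ℚ) * r * hd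
    exact mul_left_cancel₀ (by positivity) this
  have hdet' : s * p - -q * -r = 1 := by exact_mod_cast hdet
  have hcomp := Q'.1.slEquiv_of_entries s (-q) (-r) p hdet'
  have : Q.1 = Q'.1.comp !![s, -q; -r, p] := by
    apply eq_of_l_m
    · rw [hcomp.disc_eq, Q.2.1, Q'.2.1]
    · have : Q.1.l = Q'.1.l * s ^ 2 - Q'.1.m * s * r + Q'.1.r * r ^ 2 := by exact_mod_cast E1
      rw [this]; simp [BinForm.comp, BinForm.eval]; ring
    · have : Q.1.m = 2 * Q'.1.l * s * (-q) + Q'.1.m * (s * p + -q * -r)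
        + 2 * Q'.1.r * (-r) * p := by exact_mod_cast hm
      rw [this]; simp [BinForm.comp]
    · exact l_ne_zero Q
  exact (this ▸ hcomp).symm

theorem root_relation (Q : PrimForm Δ) :
    (Q.1.l : K Δ) * root Q ^ 2 = -(Q.1.m : K Δ) * root Q - (Q.1.r : K Δ) := by
  have h0 := l_ne_zero' Q
  have hd := disc_eq' Q
  rw [pow_two]
  ext
  · simp only [root, QuadraticAlgebra.re_sub, QuadraticAlgebra.re_neg, QuadraticAlgebra.im_neg,
      QuadraticAlgebra.re_mul, QuadraticAlgebra.im_mul, QuadraticAlgebra.re_intCast,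
      QuadraticAlgebra.im_intCast]
    field_simp
    linear_combination -(Q.1.l : ℚ) * hd
  · simp only [root, QuadraticAlgebra.im_sub, QuadraticAlgebra.re_neg, QuadraticAlgebra.im_neg,
      QuadraticAlgebra.re_mul, QuadraticAlgebra.im_mul, QuadraticAlgebra.re_intCast,
      QuadraticAlgebra.im_intCast]
    field_simp
    ring

theorem root_of_composition {Qa Qb Qc : PrimForm Δ} (h : IsComposition Qa Qb Qc) :
    root Qa = (Qb.1.l : K Δ) * root Qc ∧ root Qb = (Qa.1.l : K Δ) * root Qc := by
  obtain ⟨-, hm, hl, hm'⟩ := h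
  have ha := l_ne_zero' Qa
  have hb := l_ne_zero' Qb
  constructor <;> ext <;>
  · simp only [root, QuadraticAlgebra.re_mul, QuadraticAlgebra.im_mul,
      QuadraticAlgebra.re_intCast, QuadraticAlgebra.im_intCast, hl, hm', ← hm]
    push_cast
    field_simp
    try ring

theorem inLattice_mul {Qa Qb Qc : PrimForm Δ} (h : IsComposition Qa Qb Qc) {z w : K Δ}
    (hz : InLattice Qa z) (hw : InLattice Qb w) : InLattice Qc (z * w) := by
  obtain ⟨x, y, rfl⟩ := hz
  obtain ⟨x', y', rfl⟩ := hw
  have hq := root_relation Qc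
  obtain ⟨ha, hb⟩ := root_of_composition h
  rw [h.2.2.1] at hq
  refine ⟨x * x' - y * y' * Qc.1.r,
    x * y' * Qa.1.l + y * x' * Qb.1.l - y * y' * Qc.1.m, ?_⟩
  rw [ha, hb]
  push_cast at hq ⊢
  linear_combination (y : K Δ) * y' * hq

theorem homothetic_composition {Qa Qb Qc Qa' Qb' Qc' : PrimForm Δ}
    (h : IsComposition Qa Qb Qc) (h' : IsComposition Qa' Qb' Qc')
    (ha : Homothetic Qa Qa') (hb : Homothetic Qb Qb') : Homothetic Qc Qc' := by
  obtain ⟨z, hz, hz1, hz2⟩ := ha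
  obtain ⟨w, hw, hw1, hw2⟩ := hb
  refine ⟨z * w, ?_, inLattice_mul h' hz1 hw1, ?_⟩
  · rw [h.2.2.1, h'.2.2.1]
    push_cast
    rw [← hz, ← hw]
    simp only [QuadraticAlgebra.re_mul, QuadraticAlgebra.im_mul]
    ring
  · obtain ⟨u, v, huv⟩ := h.1
    obtain ⟨h1, h2⟩ := root_of_composition h
    have huv' : (u : K Δ) * Qa.1.l + v * Qb.1.l = 1 := by exact_mod_cast huv
    have : z * w * root Qc = (u : K Δ) * (z * (w * root Qb)) + (v : K Δ) * (z * root Qa * w) := by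
      rw [h1, h2]
      linear_combination -(z * w * root Qc) * huv'
    rw [this]
    exact ((inLattice_mul h' hz1 hw2).int_mul u).add ((inLattice_mul h' hz2 hw1).int_mul v)

theorem composition_unique {Qa Qb Qc Qa' Qb' Qc' : PrimForm Δ}
    (h : IsComposition Qa Qb Qc) (h' : IsComposition Qa' Qb' Qc')
    (ha : mk Qa = mk Qa') (hb : mk Qb = mk Qb') : mk Qc = mk Qc' :=
  mk_eq_mk.2 (slEquiv_of_homothetic (homothetic_composition h h'
    (homothetic_of_slEquiv (mk_eq_mk.1 ha)) (homothetic_of_slEquiv (mk_eq_mk.1 hb))))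

/-- Gauss composition: the product of two classes is the class of the composition of two forms
that represent them and for which it is defined; see `mk_mul_mk`. -/
noncomputable instance : Mul (Cl Δ) := ⟨fun A B => (exists_composition A B).choose⟩

theorem mk_mul_mk {Qa Qb Qc : PrimForm Δ} (h : IsComposition Qa Qb Qc) :
    mk Qa * mk Qb = mk Qc := by
  obtain ⟨Qa', Qb', Qc', ha, hb, hc, h'⟩ := (exists_composition (mk Qa) (mk Qb)).choose_spec
  exact hc.symm.trans (composition_unique h' h ha hb)

/-- The principal form `x² + ε x y + ((ε - Δ) / 4) y²`, where `ε ∈ {0, 1}` and `Δ ≡ ε mod 4`. -/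
def principalForm (Δ : ℤ) [NonsquareDisc Δ] : PrimForm Δ :=
  ⟨⟨1, Δ % 4, (Δ % 4 - Δ) / 4⟩, by
    have h4 : 4 * ((Δ % 4 - Δ) / 4) = Δ % 4 - Δ := by omega
    simp only [BinForm.disc]
    rcases NonsquareDisc.mod_four (Δ := Δ) with h | h <;> rw [h] at h4 ⊢ <;>
      linear_combination -h4,
   fun _ h _ _ => isUnit_of_dvd_one h⟩

instance : One (Cl Δ) := ⟨mk (principalForm Δ)⟩

theorem one_def : (1 : Cl Δ) = mk (principalForm Δ) := rfl

theorem mk_eq_one {Q : PrimForm Δ} (h : Q.1.l = 1) : mk Q = 1 := by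
  obtain ⟨k, hk⟩ := exists_even Q (principalForm Δ)
  obtain ⟨Q', h1, h2, h3, -⟩ := exists_shift Q k
  rw [← h1, one_def]
  congr 1
  apply Subtype.ext
  apply eq_of_l_m
  · rw [Q'.2.1, (principalForm Δ).2.1]
  · rw [h2, h]; rfl
  · rw [h3, hk, h]; ring
  · exact l_ne_zero Q'

theorem exists_coprime_ends (A : Cl Δ) : ∃ Q : PrimForm Δ, mk Q = A ∧ IsCoprime Q.1.l Q.1.r := by
  obtain ⟨Q, rfl⟩ := exists_mk A
  obtain ⟨t, ht, -⟩ := exists_separating Q.1.l (l_ne_zero Q) (fun p => ¬ (p : ℤ) ∣ Q.1.r)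
  obtain ⟨Q', h1, h2, -, h4⟩ := exists_shift Q t
  refine ⟨Q', h1, ?_⟩
  rw [h2, h4]
  refine isCoprime_of_primes fun p hp hl h => ?_
  have hpi : Prime (p : ℤ) := Nat.prime_iff_prime_int.1 hp
  have ht' := ht p hp hl
  have h5 : (p : ℤ) ∣ Q.1.m * t + Q.1.r := by
    have := dvd_sub h (hl.mul_right (t ^ 2))
    ring_nf at this ⊢; exact this
  by_cases hr : (p : ℤ) ∣ Q.1.r
  · rcases hpi.dvd_or_dvd ((dvd_add_left hr).1 h5) with h6 | h6
    · exact not_all_dvd Q.2.2 hp hl h6 hr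
    · exact ht'.1 h6 hr
  · exact hr ((dvd_add_right ((ht'.2 hr).mul_left _)).1 h5)

protected theorem mul_comm (A B : Cl Δ) : A * B = B * A := by
  obtain ⟨C, Qa, Qb, Qc, rfl, rfl, rfl, h⟩ := exists_composition A B
  rw [mk_mul_mk h, mk_mul_mk (Qc := Qc) ⟨h.1.symm, h.2.1.symm, by rw [h.2.2.1, mul_comm],
    h.2.2.2.trans h.2.1⟩]

protected theorem one_mul (A : Cl Δ) : 1 * A = A := by
  obtain ⟨Q, rfl⟩ := exists_mk A
  obtain ⟨k, hk⟩ := exists_even (principalForm Δ) Q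
  obtain ⟨P, h1, h2, h3, -⟩ := exists_shift (principalForm Δ) k
  have hl : (principalForm Δ).1.l = 1 := rfl
  rw [one_def, ← h1]
  exact mk_mul_mk ⟨by rw [h2, hl]; exact isCoprime_one_left, by rw [h3, hk, hl]; ring,
    by rw [h2, hl, one_mul], by rw [h3, hk, hl]; ring⟩

protected theorem inv_mul_cancel (A : Cl Δ) : A⁻¹ * A = 1 := by
  obtain ⟨Q, rfl, hQ⟩ := exists_coprime_ends A
  obtain ⟨Q', h1, h2, h3, -⟩ := mk_swap (opp Q)
  have h2' : Q'.1.l = Q.1.r := h2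
  have h3' : Q'.1.m = Q.1.m := by rw [h3]; simp [opp]
  obtain ⟨C, hC⟩ := exists_isComposition Q' Q (by rw [h2']; exact hQ.symm) h3'
  rw [inv_mk, ← h1, mk_mul_mk hC]
  obtain ⟨C', h4, h5, -, -⟩ := mk_swap C
  rw [← h4]
  apply mk_eq_one
  rw [h5]
  have hc := disc_eq C
  have hq := disc_eq Q
  rw [hC.2.2.1, hC.2.2.2, h2', h3'] at hc
  have hne : 4 * (Q.1.r * Q.1.l) ≠ 0 := by
    have := l_ne_zero Q'
    rw [h2'] at this
    simp [this, l_ne_zero Q]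
  apply mul_left_cancel₀ hne
  linear_combination hq - hc

protected theorem mul_assoc (A B C : Cl Δ) : A * B * C = A * (B * C) := by
  obtain ⟨D, Qa, Qb, Qd, rfl, rfl, rfl, h⟩ := exists_composition A B
  obtain ⟨Qc, rfl, hc⟩ := exists_coprime_rep C (l_ne_zero Qd)
  obtain ⟨s, t, hst⟩ := exists_align Qd Qc hc.symm
  obtain ⟨Qd', hd, hdl, hdm, -⟩ := exists_shift Qd s
  obtain ⟨Qc', hc', hcl, hcm, -⟩ := exists_shift Qc t
  obtain ⟨Qa', ha, hal, ham, -⟩ := exists_shift Qa (Qb.1.l * s)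
  obtain ⟨Qb', hb, hbl, hbm, -⟩ := exists_shift Qb (Qa.1.l * s)
  obtain ⟨h1, h2, h3, h4⟩ := h
  rw [h3] at hc hst hdm hdl
  have hcab := IsCoprime.mul_right_iff.1 hc
  have hab : IsComposition Qa' Qb' Qd' := ⟨by rw [hal, hbl]; exact h1,
    by rw [ham, hbm, h2]; ring, by rw [hdl, hal, hbl], by rw [hdm, ham, h4]; ring⟩
  have hdc : Qd'.1.m = Qc'.1.m := by rw [hdm, hcm, hst]
  obtain ⟨Qe, he⟩ := exists_isComposition Qd' Qc' (by rw [hdl, hcl]; exact hc.symm) hdc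
  obtain ⟨Qf, hf⟩ := exists_isComposition Qb' Qc' (by rw [hbl, hcl]; exact hcab.2.symm)
    (by rw [← hab.2.1, ← hab.2.2.2, hdc])
  rw [← ha, ← hb, ← hc', mk_mul_mk hab, mk_mul_mk he, mk_mul_mk hf]
  symm
  apply mk_mul_mk
  refine ⟨?_, ?_, ?_, ?_⟩
  · rw [hf.2.2.1, hal, hbl, hcl]; exact h1.mul_right hcab.1.symm
  · rw [hf.2.2.2, hab.2.1]
  · rw [he.2.2.1, hf.2.2.1, hab.2.2.1, mul_assoc]
  · rw [he.2.2.2, hab.2.2.2]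

/-- The Gauss class group. -/
noncomputable instance : CommGroup (Cl Δ) where
  mul_assoc := Cl.mul_assoc
  one_mul := Cl.one_mul
  mul_one A := by rw [Cl.mul_comm, Cl.one_mul]
  inv_mul_cancel := Cl.inv_mul_cancel
  mul_comm := Cl.mul_comm

/-- The subgroup `Cl(Δ)²` of squares. -/
noncomputable def squares (Δ : ℤ) [NonsquareDisc Δ] : Subgroup (Cl Δ) :=
  (powMonoidHom 2 : Cl Δ →* Cl Δ).range

end

end Cl

/-! Everything is read off from the values that a class takes over a ring `R`. Over a domain of
characteristic zero, two forms of discriminant Δ that take a common unit value are equivalent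
(`BinForm.slEquiv_of_represents`). Values multiply under Gauss composition (`Cl.Represents.mul`),
and inverse classes take the same values. Hence, when every class takes a unit value over `R`,
equivalence of `A` and `B` over `R` means that `A * B⁻¹` takes the value 1
(`Cl.equivOver_iff_mul_inv`). So genera and ℚ-classes are the cosets of two subgroups, both of which
contain the squares, because `A * A` takes the value u² of a unit u.

The deep inclusion is `Cl.principalGenus_le_squares`. If Q takes the value 1 over ℝ and all ℤ_p, the
conic x² = Δy² + lz² has points everywhere locally, hence over ℚ by Legendre's descent
(`LocallySolvable.conicSolvable`), so Q(x, y) is a nonzero square for some integers. Weak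
approximation on the conic Q(x, y) = z² makes x, y coprime and z coprime to Δ. Then Q is equivalent
to a form (d², m, r), whose class is the square of that of (d, m, dr). With squares inside the
ℚ-subgroup, this also shows that genera refine ℚ-classes.

For the converse with Δ fundamental, a class that takes the value 1 over ℚ takes a value d² at
coprime integers. At p not dividing d this is the square of a unit. At p dividing d, fundamentality
keeps p from dividing m, and Hensel's lemma gives the value 1. -/

/-! ### Equivalence of forms through a common unit value -/

namespace BinForm

variable {R : Type*} [CommRing R]

/-- `Q` takes the value `u`. -/
def Represents (Q : BinForm R) (u : R) : Prop := ∃ x y, Q.eval x y = u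

theorem SLEquiv.represents {Q Q' : BinForm R} {u : R} (h : SLEquiv Q Q') (hu : Q.Represents u) :
    Q'.Represents u := by
  obtain ⟨M, rfl⟩ := h.symm
  obtain ⟨x, y, rfl⟩ := hu
  exact ⟨_, _, (eval_comp Q' M.1 x y).symm⟩

/-- A form which takes a unit value is equivalent to one with this value as first coefficient. -/
theorem exists_slEquiv_l_eq {Q : BinForm R} {u : R} (hu : IsUnit u) (h : Q.Represents u) :
    ∃ Q', SLEquiv Q Q' ∧ Q'.l = u ∧ ∃ k, Q'.m = Q.m + 2 * k := by
  obtain ⟨x, y, hxy⟩ := h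
  obtain ⟨v, hv⟩ := hu.exists_right_inv
  unfold eval at hxy
  -- The second column comes from Q(x, y) = x(lx + my) + y(ry), divided by u.
  have hdet : x * (v * (Q.l * x + Q.m * y)) - -(v * (Q.r * y)) * y = 1 := by
    linear_combination v * hxy + hv
  refine ⟨_, Q.slEquiv_of_entries _ _ _ _ hdet, by simpa [comp, eval] using hxy,
    Q.l * x * (-(v * (Q.r * y))) - Q.m * (v * (Q.r * y)) * y +
      Q.r * y * (v * (Q.l * x + Q.m * y)), ?_⟩
  simp only [comp, Matrix.of_apply, Matrix.cons_val', Matrix.cons_val_zero, Matrix.cons_val_one,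
    Matrix.cons_val_fin_one]
  linear_combination Q.m * hdet

/-- Forms with the same discriminant and middle coefficients of the same parity are equivalent as
soon as they take a common unit value. -/
theorem slEquiv_of_represents [IsDomain R] [CharZero R] {Q Q' : BinForm R} {u : R} (hu : IsUnit u)
    (hd : Q.disc = Q'.disc) (hm : ∃ k, Q'.m = Q.m + 2 * k) (h : Q.Represents u)
    (h' : Q'.Represents u) : SLEquiv Q Q' := by
  obtain ⟨P, hP, hl, k, hk⟩ := exists_slEquiv_l_eq hu h
  obtain ⟨P', hP', hl', k', hk'⟩ := exists_slEquiv_l_eq hu h'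
  obtain ⟨j, hj⟩ := hm
  obtain ⟨v, hv⟩ := hu.exists_right_inv
  -- A shear by t adds 2ut to the middle coefficient; this t turns `P.m` into `P'.m`. The
  -- discriminant then fixes the last coefficient, as 4u is nonzero.
  have hS := P.slEquiv_of_entries 1 (v * (j + k' - k)) 0 1 (by ring)
  refine (hP.trans ?_).trans hP'.symm
  have key : P.comp !![1, v * (j + k' - k); 0, 1] = P' := by
    have e1 : (P.comp !![1, v * (j + k' - k); 0, 1]).l = P'.l := by
      simp [comp, eval, hl, hl']
    have e2 : (P.comp !![1, v * (j + k' - k); 0, 1]).m = P'.m := by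
      simp only [comp, Matrix.of_apply, Matrix.cons_val', Matrix.cons_val_zero,
        Matrix.cons_val_one, Matrix.cons_val_fin_one]
      rw [hk, hk', hj, hl]
      linear_combination 2 * (j + k' - k) * hv
    have e3 : (P.comp !![1, v * (j + k' - k); 0, 1]).disc = P'.disc := by
      rw [hS.disc_eq, hP.disc_eq, hP'.disc_eq, hd]
    generalize P.comp !![1, v * (j + k' - k); 0, 1] = T at e1 e2 e3
    ext
    · exact e1
    · exact e2
    · simp only [disc, e1, e2, hl'] at e3
      have h4 : (4 * u) * T.r = (4 * u) * P'.r := by linear_combination -e3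
      exact mul_left_cancel₀ (mul_ne_zero (by norm_num) hu.ne_zero) h4
  exact key ▸ hS

end BinForm

/-! ### Values of classes and the subgroups of classes that take the value 1 -/

namespace Cl

variable {Δ : ℤ} {R : Type*} [CommRing R]

/-- The forms in the class `A` take the value `u` over `R`. -/
def Represents (R : Type*) [CommRing R] (A : Cl Δ) (u : R) : Prop :=
  ∃ Q : PrimForm Δ, mk Q = A ∧ (Q.1.map (Int.castRingHom R)).Represents u

theorem represents_mk {Q : PrimForm Δ} {u : R} :
    Represents R (mk Q) u ↔ (Q.1.map (Int.castRingHom R)).Represents u := by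
  refine ⟨?_, fun h => ⟨Q, rfl, h⟩⟩
  rintro ⟨Q', h, hu⟩
  exact ((mk_eq_mk.1 h).map _).represents hu

theorem represents_mk_iff {Q : PrimForm Δ} {u : R} :
    Represents R (mk Q) u ↔
      ∃ x y : R, (Q.1.l : R) * x ^ 2 + (Q.1.m : R) * x * y + (Q.1.r : R) * y ^ 2 = u :=
  represents_mk

theorem represents_l (Q : PrimForm Δ) : Represents R (mk Q) (Q.1.l : R) :=
  represents_mk_iff.2 ⟨1, 0, by ring⟩

theorem Represents.sq_mul {A : Cl Δ} {u : R} (h : Represents R A u) (c : R) :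
    Represents R A (c ^ 2 * u) := by
  obtain ⟨Q, rfl⟩ := exists_mk A
  obtain ⟨x, y, rfl⟩ := represents_mk_iff.1 h
  exact represents_mk_iff.2 ⟨c * x, c * y, by ring⟩

theorem Represents.map {S : Type*} [CommRing S] (φ : R →+* S) {A : Cl Δ} {u : R}
    (h : Represents R A u) : Represents S A (φ u) := by
  obtain ⟨Q, rfl⟩ := exists_mk A
  obtain ⟨x, y, rfl⟩ := represents_mk_iff.1 h
  exact represents_mk_iff.2 ⟨φ x, φ y, by simp⟩

theorem Represents.inv {A : Cl Δ} {u : R} (h : Represents R A u) : Represents R A⁻¹ u := by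
  obtain ⟨Q, rfl⟩ := exists_mk A
  obtain ⟨x, y, rfl⟩ := represents_mk_iff.1 h
  rw [inv_mk]
  exact represents_mk_iff.2 ⟨x, -y, by simp [opp]⟩

theorem equivOver_mk {Q Q' : PrimForm Δ} : EquivOver R (mk Q) (mk Q') ↔
    BinForm.SLEquiv (Q.1.map (Int.castRingHom R)) (Q'.1.map (Int.castRingHom R)) := Iff.rfl

theorem EquivOver.represents {A B : Cl Δ} {u : R} (h : EquivOver R A B)
    (hu : Represents R A u) : Represents R B u := by
  obtain ⟨Q, rfl⟩ := exists_mk A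
  obtain ⟨Q', rfl⟩ := exists_mk B
  exact represents_mk.2 ((equivOver_mk.1 h).represents (represents_mk.1 hu))

theorem EquivOver.of_represents [IsDomain R] [CharZero R] {A B : Cl Δ} {u : R} (h0 : IsUnit u)
    (hA : Represents R A u) (hB : Represents R B u) : EquivOver R A B := by
  obtain ⟨Q, rfl⟩ := exists_mk A
  obtain ⟨Q', rfl⟩ := exists_mk B
  have hdisc : ∀ P : PrimForm Δ, (P.1.map (Int.castRingHom R)).disc = (Δ : R) := fun P => by
    have := congrArg (Int.cast : ℤ → R) (disc_eq P)
    push_cast at this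
    simpa [BinForm.disc, BinForm.map] using this
  obtain ⟨k, hk⟩ := exists_even Q Q'
  exact equivOver_mk.2 (BinForm.slEquiv_of_represents h0 ((hdisc Q).trans (hdisc Q').symm)
    ⟨(k : R), by simp [BinForm.map, hk]⟩ (represents_mk.1 hA) (represents_mk.1 hB))

theorem Represents.one_of_sq {A : Cl Δ} {u : R} (hu : IsUnit u) (h : Represents R A (u * u)) :
    Represents R A 1 := by
  obtain ⟨v, hv⟩ := hu.exists_right_inv
  have := h.sq_mul v
  rwa [show v ^ 2 * (u * u) = (u * v) ^ 2 by ring, hv, one_pow] at this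

theorem _root_.PadicInt.isUnit_intCast_iff {p : ℕ} [Fact p.Prime] {n : ℤ} :
    IsUnit (n : ℤ_[p]) ↔ ¬ (p : ℤ) ∣ n := by
  rw [PadicInt.isUnit_iff, ← PadicInt.norm_int_lt_one_iff_dvd]
  have := PadicInt.norm_le_one (n : ℤ_[p])
  grind

theorem exists_isUnit_represents_padicInt (p : ℕ) [hp : Fact p.Prime] (A : Cl Δ) :
    ∃ u : ℤ_[p], IsUnit u ∧ Represents ℤ_[p] A u := by
  obtain ⟨Q, rfl, hQ⟩ := exists_coprime_rep A (n := p) (by exact_mod_cast hp.1.ne_zero)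
  refine ⟨_, PadicInt.isUnit_intCast_iff.2 fun h => ?_, represents_l Q⟩
  exact (Nat.prime_iff_prime_int.1 hp.1).not_isUnit (hQ.isUnit_of_dvd' h dvd_rfl)

variable [NonsquareDisc Δ]

/-- Equal discriminants force the shapes (a, m, bc), (b, m, ac), (ab, m, c), on which Gauss's
bilinear identity applies. -/
theorem r_eq_of_isComposition {Qa Qb Qc : PrimForm Δ} (h : IsComposition Qa Qb Qc) :
    Qa.1.r = Qb.1.l * Qc.1.r ∧ Qb.1.r = Qa.1.l * Qc.1.r := by
  obtain ⟨-, hm, hl, hm'⟩ := h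
  have ha := disc_eq Qa
  have hb := disc_eq Qb
  have hc := disc_eq Qc
  rw [← hm] at hb
  rw [hl, hm'] at hc
  constructor
  · have : (4 * Qa.1.l) * Qa.1.r = (4 * Qa.1.l) * (Qb.1.l * Qc.1.r) := by linear_combination hc - ha
    exact mul_left_cancel₀ (mul_ne_zero four_ne_zero (l_ne_zero Qa)) this
  · have : (4 * Qb.1.l) * Qb.1.r = (4 * Qb.1.l) * (Qa.1.l * Qc.1.r) := by linear_combination hc - hb
    exact mul_left_cancel₀ (mul_ne_zero four_ne_zero (l_ne_zero Qb)) this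

theorem Represents.mul {A B : Cl Δ} {u v : R} (hA : Represents R A u) (hB : Represents R B v) :
    Represents R (A * B) (u * v) := by
  obtain ⟨C, Qa, Qb, Qc, rfl, rfl, rfl, h⟩ := exists_composition A B
  obtain ⟨x, y, rfl⟩ := represents_mk_iff.1 hA
  obtain ⟨z, w, rfl⟩ := represents_mk_iff.1 hB
  rw [mk_mul_mk h]
  obtain ⟨ha, hb⟩ := r_eq_of_isComposition h
  obtain ⟨-, hm, hl, hm'⟩ := h
  -- Coordinates of (ax + yω)(bz + wω) on ab and ω, where ω² = mω - abc and c is the last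
  -- coefficient of `Qc`; the identity is multiplicativity of the norm, divided by ab.
  refine represents_mk_iff.2 ⟨x * z - Qc.1.r * y * w,
    Qa.1.l * x * w + Qb.1.l * y * z + Qc.1.m * y * w, ?_⟩
  rw [ha, hb, ← hm, hl, hm']
  push_cast
  ring

theorem represents_one : Represents R (1 : Cl Δ) 1 :=
  represents_mk_iff.2 ⟨1, 0, by simp [principalForm]⟩

/-- The classes which take the value `1` over `R`. -/
noncomputable def representingOne (Δ : ℤ) [NonsquareDisc Δ] (R : Type*) [CommRing R] : Subgroup (Cl Δ) where
  carrier := {A | Represents R A 1}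
  mul_mem' hA hB := by simpa using hA.mul hB
  one_mem' := represents_one
  inv_mem' hA := hA.inv

theorem mem_representingOne {A : Cl Δ} : A ∈ representingOne Δ R ↔ Represents R A 1 := Iff.rfl

/-- If both classes take the unit u, then `A * B⁻¹` takes u², hence 1. Conversely, `A = (A * B⁻¹) *
B` takes every value of `B`. -/
theorem equivOver_iff_mul_inv [IsDomain R] [CharZero R]
    (hR : ∀ A : Cl Δ, ∃ u : R, IsUnit u ∧ Represents R A u) (A B : Cl Δ) :
    EquivOver R A B ↔ A * B⁻¹ ∈ representingOne Δ R := by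
  rw [mem_representingOne]
  constructor
  · intro h
    obtain ⟨u, hu, hA⟩ := hR A
    exact (hA.mul (h.represents hA).inv).one_of_sq hu
  · intro h
    obtain ⟨u, hu, hB⟩ := hR B
    have hA := h.mul hB
    rw [inv_mul_cancel_right, one_mul] at hA
    exact .of_represents hu hA hB

theorem squares_le_representingOne (hR : ∀ A : Cl Δ, ∃ u : R, IsUnit u ∧ Represents R A u) :
    squares Δ ≤ representingOne Δ R := by
  rintro _ ⟨A, rfl⟩
  obtain ⟨u, hu, hA⟩ := hR A
  rw [powMonoidHom_apply, pow_two]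
  exact (hA.mul hA).one_of_sq hu

theorem exists_isUnit_represents_of_field (F : Type*) [Field F] [CharZero F] (A : Cl Δ) :
    ∃ u : F, IsUnit u ∧ Represents F A u := by
  obtain ⟨Q, rfl⟩ := exists_mk A
  exact ⟨_, (Int.cast_ne_zero.2 (l_ne_zero Q)).isUnit, represents_l Q⟩

theorem qEquiv_iff {A B : Cl Δ} : QEquiv A B ↔ A * B⁻¹ ∈ representingOne Δ ℚ :=
  equivOver_iff_mul_inv (exists_isUnit_represents_of_field ℚ) A B

/-- The classes which take the value `1` over `ℝ` and over `ℤ_p` for all primes `p`. -/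
noncomputable def principalGenus (Δ : ℤ) [NonsquareDisc Δ] : Subgroup (Cl Δ) :=
  representingOne Δ ℝ ⊓ ⨅ (p : ℕ) (_ : Fact p.Prime), representingOne Δ ℤ_[p]

theorem mem_principalGenus {A : Cl Δ} : A ∈ principalGenus Δ ↔
    Represents ℝ A 1 ∧ ∀ (p : ℕ) [Fact p.Prime], Represents ℤ_[p] A 1 := by
  simp [principalGenus, Subgroup.mem_inf, Subgroup.mem_iInf, mem_representingOne]

theorem sameGenus_iff {A B : Cl Δ} : SameGenus A B ↔ A * B⁻¹ ∈ principalGenus Δ := by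
  rw [mem_principalGenus]
  exact and_congr (equivOver_iff_mul_inv (exists_isUnit_represents_of_field ℝ) A B)
    (forall_congr' fun p => forall_congr' fun _ =>
      equivOver_iff_mul_inv (exists_isUnit_represents_padicInt p) A B)

theorem squares_le_principalGenus : squares Δ ≤ principalGenus Δ := fun _ hA =>
  mem_principalGenus.2 ⟨squares_le_representingOne (exists_isUnit_represents_of_field ℝ) hA,
    fun p _ => squares_le_representingOne (exists_isUnit_represents_padicInt p) hA⟩

end Cl

/-! ### The Hasse principle for conics -/

/-- The conic `x² = a y² + b z²` has a point over `F`. -/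
def ConicSolvable {F : Type*} [Field F] (a b : F) : Prop :=
  ∃ x y z : F, (x ≠ 0 ∨ y ≠ 0 ∨ z ≠ 0) ∧ x ^ 2 = a * y ^ 2 + b * z ^ 2

namespace ConicSolvable

variable {F : Type*} [Field F] {a b b' c t : F}

theorem symm (h : ConicSolvable a b) : ConicSolvable b a := by
  obtain ⟨x, y, z, h0, h⟩ := h
  exact ⟨x, z, y, by tauto, by rw [h, add_comm]⟩

theorem mul_sq (hc : c ≠ 0) (h : ConicSolvable a b) : ConicSolvable a (b * c ^ 2) := by
  obtain ⟨x, y, z, h0, h⟩ := h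
  refine ⟨c * x, c * y, z, by simpa [hc] using h0, ?_⟩
  linear_combination c ^ 2 * h

theorem of_mul_sq (hc : c ≠ 0) (h : ConicSolvable a (b * c ^ 2)) : ConicSolvable a b := by
  obtain ⟨x, y, z, h0, h⟩ := h
  exact ⟨x, y, c * z, by simpa [hc] using h0, by linear_combination h⟩

/-- Since bb' is the norm of t + √a, b is a norm from F(√a) exactly when b' is. The new point is (x
+ y√a)(t + √a); when z = 0 the old point serves for every b'. -/
theorem of_norm (hb : b ≠ 0) (ht : t ^ 2 - a = b * b') (h : ConicSolvable a b) :
    ConicSolvable a b' := by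
  obtain ⟨x, y, z, h0, h⟩ := h
  by_cases hz : z = 0
  · exact ⟨x, y, 0, by simpa [hz] using h0, by rw [h, hz]; ring⟩
  · refine ⟨x * t + a * y, x + t * y, b * z, by simp [hb, hz], ?_⟩
    linear_combination (t ^ 2 - a) * h + b * z ^ 2 * ht

theorem of_eq_sq (h : a = t ^ 2) : ConicSolvable a b := ⟨t, 1, 0, by simp, by rw [h]; ring⟩

end ConicSolvable

namespace PadicInt

variable {p : ℕ} [hp : Fact p.Prime]

theorem exists_int_pow_dvd_sub (x : ℤ_[p]) (n : ℕ) : ∃ k : ℤ, (p : ℤ_[p]) ^ n ∣ x - k :=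
  ⟨x.appr n, by simpa using Ideal.mem_span_singleton.1 (appr_spec n x)⟩

theorem dvd_intCast_iff {n : ℤ} : (p : ℤ_[p]) ∣ n ↔ (p : ℤ) ∣ n := by
  simpa using pow_p_dvd_int_iff 1 n

end PadicInt

namespace ConicSolvable

variable {p : ℕ} [hp : Fact p.Prime]

/-- Dividing by a coordinate of largest norm makes all three integral and one of them equal to 1. -/
theorem exists_primitive {a b : ℤ} (h : ConicSolvable (a : ℚ_[p]) b) : ∃ x y z : ℤ_[p],
    ¬ ((p : ℤ_[p]) ∣ x ∧ (p : ℤ_[p]) ∣ y ∧ (p : ℤ_[p]) ∣ z) ∧ x ^ 2 = a * y ^ 2 + b * z ^ 2 := by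
  obtain ⟨x, y, z, h0, h⟩ := h
  obtain ⟨w, hw, hx, hy, hz, hxyz⟩ : ∃ w : ℚ_[p], w ≠ 0 ∧ ‖x‖ ≤ ‖w‖ ∧ ‖y‖ ≤ ‖w‖ ∧ ‖z‖ ≤ ‖w‖ ∧
      (x = w ∨ y = w ∨ z = w) := by
    have key : ∃ w, ‖x‖ ≤ ‖w‖ ∧ ‖y‖ ≤ ‖w‖ ∧ ‖z‖ ≤ ‖w‖ ∧ (x = w ∨ y = w ∨ z = w) := by
      rcases le_total ‖x‖ ‖y‖ with h1 | h1 <;> rcases le_total ‖y‖ ‖z‖ with h2 | h2 <;>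
        rcases le_total ‖x‖ ‖z‖ with h3 | h3
      · exact ⟨z, h3, h2, le_rfl, by simp⟩
      · exact ⟨z, h1.trans h2, h2, le_rfl, by simp⟩
      · exact ⟨y, h1, le_rfl, h2, by simp⟩
      · exact ⟨y, h1, le_rfl, h2, by simp⟩
      · exact ⟨z, h3, h2, le_rfl, by simp⟩
      · exact ⟨x, le_rfl, h1, h3, by simp⟩
      · exact ⟨x, le_rfl, h1, h2.trans h1, by simp⟩
      · exact ⟨x, le_rfl, h1, h3, by simp⟩
    obtain ⟨w, hx, hy, hz, hxyz⟩ := key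
    refine ⟨w, ?_, hx, hy, hz, hxyz⟩
    rintro rfl
    simp only [norm_zero, norm_le_zero_iff] at hx hy hz
    simp [hx, hy, hz] at h0
  have hle : ∀ v : ℚ_[p], ‖v‖ ≤ ‖w‖ → ∃ u : ℤ_[p], (u : ℚ_[p]) = v / w := fun v hv =>
    ⟨⟨v / w, by rw [norm_div]; exact div_le_one_of_le₀ hv (norm_nonneg w)⟩, rfl⟩
  obtain ⟨X, hX⟩ := hle x hx
  obtain ⟨Y, hY⟩ := hle y hy
  obtain ⟨Z, hZ⟩ := hle z hz
  refine ⟨X, Y, Z, ?_, ?_⟩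
  · rintro ⟨h1, h2, h3⟩
    have hone : ∀ u : ℤ_[p], (u : ℚ_[p]) = w / w → ¬ (p : ℤ_[p]) ∣ u := fun u hu => by
      rw [div_self hw] at hu
      rw [← PadicInt.norm_lt_one_iff_dvd, PadicInt.norm_def, hu, norm_one]
      exact lt_irrefl 1
    rcases hxyz with rfl | rfl | rfl
    · exact hone X hX h1
    · exact hone Y hY h2
    · exact hone Z hZ h3
  · apply PadicInt.ext
    push_cast
    rw [hX, hY, hZ]
    field_simp
    exact h

/-- In a primitive solution y is a unit: p dividing y would divide x, then p² would divide bz², and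
p would divide z since it divides b only once. So t ≡ x/y works. -/
theorem exists_dvd_sq_sub {a b : ℤ} (hb : (p : ℤ) ∣ b) (hb' : ¬ (p : ℤ) ^ 2 ∣ b)
    (h : ConicSolvable (a : ℚ_[p]) b) : ∃ t : ℤ, (p : ℤ) ∣ t ^ 2 - a := by
  obtain ⟨x, y, z, h0, h⟩ := exists_primitive h
  have hpp : Prime (p : ℤ_[p]) := PadicInt.prime_p
  obtain ⟨c, rfl⟩ := hb
  have hc : ¬ (p : ℤ_[p]) ∣ (c : ℤ_[p]) := fun hc => hb' (by
    rw [pow_two]; exact mul_dvd_mul_left _ (PadicInt.dvd_intCast_iff.1 hc))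
  have hy : ¬ (p : ℤ_[p]) ∣ y := by
    rintro ⟨y', rfl⟩
    have hx : (p : ℤ_[p]) ∣ x := by
      apply hpp.dvd_of_dvd_pow (n := 2)
      rw [h]
      push_cast
      exact ⟨a * (p * y' ^ 2) + c * z ^ 2, by ring⟩
    obtain ⟨x', rfl⟩ := hx
    have hz : (p : ℤ_[p]) ∣ c * z ^ 2 := by
      refine ⟨x' ^ 2 - a * y' ^ 2, ?_⟩
      apply mul_left_cancel₀ hpp.ne_zero
      push_cast at h
      linear_combination -h
    exact h0 ⟨⟨x', rfl⟩, ⟨y', rfl⟩, hpp.dvd_of_dvd_pow ((hpp.dvd_or_dvd hz).resolve_left hc)⟩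
  have hyu : IsUnit y := by
    rw [← PadicInt.norm_lt_one_iff_dvd] at hy
    rw [PadicInt.isUnit_iff]
    exact le_antisymm (PadicInt.norm_le_one y) (not_lt.1 hy)
  obtain ⟨v, hv⟩ := hyu.exists_right_inv
  obtain ⟨t, d, ht⟩ := PadicInt.exists_int_pow_dvd_sub (x * v) 1
  refine ⟨t, PadicInt.dvd_intCast_iff.1 ⟨c * z ^ 2 * v ^ 2 - d * (x * v + t), ?_⟩⟩
  push_cast at h ⊢
  linear_combination v ^ 2 * h - (x * v + t) * ht + a * (y * v + 1) * hv

end ConicSolvable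

theorem Int.exists_forall_dvd_sub (s : Finset ℕ) (hs : ∀ p ∈ s, p.Prime) (e : ℕ → ℕ) (x : ℕ → ℤ) :
    ∃ y : ℤ, ∀ p ∈ s, (p : ℤ) ^ e p ∣ y - x p := by
  have hco : Pairwise (Function.onFun IsCoprime
      fun p : s => Ideal.span {((p : ℕ) : ℤ) ^ e p}) := by
    intro p q hpq
    rw [Function.onFun, Ideal.isCoprime_span_singleton_iff]
    refine IsCoprime.pow (Nat.isCoprime_iff_coprime.2 ?_)
    exact (Nat.coprime_primes (hs _ p.2) (hs _ q.2)).2 fun h => hpq (Subtype.ext h)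
  obtain ⟨y, hy⟩ := Ideal.exists_forall_sub_mem_ideal hco fun p => x p
  exact ⟨y, fun p hp => Ideal.mem_span_singleton.1 (hy ⟨p, hp⟩)⟩

/-- An integer which is a square modulo all primes dividing a squarefree integer is a square
modulo that integer. -/
theorem Int.exists_dvd_sq_sub_of_squarefree {a b : ℤ} (hb : Squarefree b)
    (h : ∀ p : ℕ, p.Prime → (p : ℤ) ∣ b → ∃ t : ℤ, (p : ℤ) ∣ t ^ 2 - a) :
    ∃ t : ℤ, b ∣ t ^ 2 - a := by
  choose! t ht using h
  have hs : ∀ p ∈ b.natAbs.primeFactors, p.Prime := fun p hp => Nat.prime_of_mem_primeFactors hp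
  obtain ⟨y, hy⟩ := Int.exists_forall_dvd_sub b.natAbs.primeFactors hs (fun _ => 1) t
  refine ⟨y, Int.natAbs_dvd.1 ?_⟩
  rw [← Nat.prod_primeFactors_of_squarefree (Int.squarefree_natAbs.2 hb), Nat.cast_prod]
  refine Finset.prod_dvd_of_coprime (fun p hp q hq hpq => Nat.isCoprime_iff_coprime.2
    ((Nat.coprime_primes (hs p hp) (hs q hq)).2 hpq)) fun p hp => ?_
  have h1 := hy p hp
  have h2 := ht p (hs p hp) (Int.natCast_dvd.2 (Nat.dvd_of_mem_primeFactors hp))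
  rw [pow_one] at h1
  have h3 := dvd_add (h1.mul_right (y + t p)) h2
  rwa [show (y - t p) * (y + t p) + (t p ^ 2 - a) = y ^ 2 - a by ring] at h3

/-- The bound by half of |b| is what makes the descent decrease. -/
theorem Int.exists_dvd_sub_two_mul_abs_le (t : ℤ) {b : ℤ} (hb : b ≠ 0) :
    ∃ s : ℤ, b ∣ s - t ∧ 2 * |s| ≤ |b| := by
  refine ⟨t.bmod b.natAbs, ?_, ?_⟩
  · rw [← Int.natAbs_dvd]
    exact (show t ≡ t.bmod b.natAbs [ZMOD b.natAbs] from (Int.bmod_emod ..).symm).dvd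
  · have h0 : 0 < b.natAbs := Int.natAbs_pos.2 hb
    have h1 := Int.bmod_lt (x := t) h0
    have h2 := Int.le_bmod (x := t) h0
    rw [Int.abs_eq_natAbs, Int.abs_eq_natAbs]
    omega

/-- The conic `x² = a y² + b z²` has points over `ℝ` and over `ℚ_p` for all primes `p`. -/
def LocallySolvable (a b : ℤ) : Prop :=
  ConicSolvable (a : ℝ) b ∧ ∀ (p : ℕ) [Fact p.Prime], ConicSolvable (a : ℚ_[p]) b

namespace LocallySolvable

variable {a b b' c t : ℤ}

theorem symm (h : LocallySolvable a b) : LocallySolvable b a :=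
  ⟨h.1.symm, fun p _ => (h.2 p).symm⟩

theorem of_mul_sq (hc : c ≠ 0) (h : LocallySolvable a (b * c ^ 2)) : LocallySolvable a b := by
  refine ⟨.of_mul_sq (c := (c : ℝ)) (by exact_mod_cast hc) (by simpa using h.1), fun p _ =>
    .of_mul_sq (c := (c : ℚ_[p])) (by exact_mod_cast hc) (by simpa using h.2 p)⟩

theorem of_norm (hb : b ≠ 0) (ht : t ^ 2 - a = b * b') (h : LocallySolvable a b) :
    LocallySolvable a b' :=
  ⟨h.1.of_norm (t := (t : ℝ)) (by exact_mod_cast hb) (by exact_mod_cast ht), fun p _ =>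
    (h.2 p).of_norm (t := (t : ℚ_[p])) (by exact_mod_cast hb) (by exact_mod_cast ht)⟩

/-- The Hasse principle for conics. -/
theorem conicSolvable (ha : a ≠ 0) (hb : b ≠ 0) (h : LocallySolvable a b) :
    ConicSolvable (a : ℚ) b := by
  -- Legendre's descent: with |a| ≤ |b| and b squarefree, a is a square s² modulo b, and b is
  -- replaced by b' = (s² - a)/b; `of_norm` goes down for local points and back up for the rational
  -- one.
  induction hn : a.natAbs + b.natAbs using Nat.strong_induction_on generalizing a b with
  | _ n ih =>
  subst hn
  wlog hab : a.natAbs ≤ b.natAbs generalizing a b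
  · exact (this hb ha h.symm (fun m hm => ih m (by omega)) (by omega)).symm
  by_cases hsq : Squarefree b
  · by_cases hb1 : b.natAbs = 1
    · have ha1 : a.natAbs = 1 := by have := Int.natAbs_pos.2 ha; omega
      rcases Int.natAbs_eq_iff.1 ha1 with rfl | rfl
      · exact .of_eq_sq (t := 1) (by simp)
      rcases Int.natAbs_eq_iff.1 hb1 with rfl | rfl
      · exact (ConicSolvable.of_eq_sq (t := 1) (by simp)).symm
      -- The case a = b = -1, excluded by the real place.
      obtain ⟨x, y, z, h0, h⟩ := h.1
      push_cast at h
      have hx : x = 0 := by nlinarith [sq_nonneg x, sq_nonneg y, sq_nonneg z]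
      have hy : y = 0 := by nlinarith [sq_nonneg x, sq_nonneg y, sq_nonneg z]
      have hz : z = 0 := by nlinarith [sq_nonneg x, sq_nonneg y, sq_nonneg z]
      simp [hx, hy, hz] at h0
    · obtain ⟨t, ht⟩ := Int.exists_dvd_sq_sub_of_squarefree (a := a) hsq fun p hp hpb => by
        have : Fact p.Prime := ⟨hp⟩
        refine (h.2 p).exists_dvd_sq_sub hpb fun h2 => ?_
        exact (Nat.prime_iff_prime_int.1 hp).not_isUnit (hsq _ (by rwa [← pow_two]))
      obtain ⟨s, hs, hs'⟩ := Int.exists_dvd_sub_two_mul_abs_le t hb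
      obtain ⟨b', hb'⟩ : b ∣ s ^ 2 - a := by
        have := dvd_add (hs.mul_right (s + t)) ht
        rwa [show (s - t) * (s + t) + (t ^ 2 - a) = s ^ 2 - a by ring] at this
      by_cases hb0 : b' = 0
      · exact .of_eq_sq (t := (s : ℚ)) (by
          have : a = s ^ 2 := by rw [hb0] at hb'; linear_combination -hb'
          exact_mod_cast this)
      -- |b'| ≤ |b|/4 + 1 < |b|, because |b| ≥ 2.
      have hlt : b'.natAbs < b.natAbs := by
        have h1 : |b| * |b'| ≤ |s| ^ 2 + |a| := by
          rw [← abs_mul, ← hb', ← abs_pow]; exact abs_sub _ _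
        have h2 : |a| ≤ |b| := by rw [Int.abs_eq_natAbs, Int.abs_eq_natAbs]; exact_mod_cast hab
        have h3 : 2 ≤ |b| := by
          have := Int.natAbs_pos.2 hb
          rw [Int.abs_eq_natAbs]; omega
        have h4 : |b'| < |b| := by
          by_contra! h5
          have h6 := abs_nonneg s
          nlinarith
        rw [Int.abs_eq_natAbs, Int.abs_eq_natAbs] at h4
        omega
      refine (ih _ (by omega) ha hb0 (h.of_norm hb hb') rfl).of_norm (t := (s : ℚ))
        (by exact_mod_cast hb0) ?_
      rw [mul_comm]
      exact_mod_cast hb'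
  · obtain ⟨p, hp, c, rfl⟩ : ∃ p : ℤ, ¬ IsUnit p ∧ p * p ∣ b := by
      simp only [Squarefree, not_forall] at hsq
      obtain ⟨p, h1, h2⟩ := hsq
      exact ⟨p, h2, h1⟩
    have hp0 : p ≠ 0 := by rintro rfl; simp at hb
    have hc0 : c ≠ 0 := by rintro rfl; simp at hb
    have hlt : c.natAbs < (p * p * c).natAbs := by
      rw [Int.natAbs_mul, Int.natAbs_mul]
      have h1 : 2 ≤ p.natAbs := by
        have := Int.natAbs_pos.2 hp0
        rw [Int.isUnit_iff_natAbs_eq] at hp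
        omega
      have := Int.natAbs_pos.2 hc0
      nlinarith [Nat.mul_le_mul h1 h1]
    rw [show p * p * c = c * p ^ 2 by ring] at h ⊢
    push_cast
    exact (ih _ (by omega) ha hc0 (h.of_mul_sq hp0) rfl).mul_sq (by exact_mod_cast hp0)

end LocallySolvable

/-! ### Integral points and weak approximation on Q(x, y) = z² -/

theorem ConicSolvable.exists_int {a b : ℤ} (h : ConicSolvable (a : ℚ) b) :
    ∃ x y z : ℤ, (x ≠ 0 ∨ y ≠ 0 ∨ z ≠ 0) ∧ x ^ 2 = a * y ^ 2 + b * z ^ 2 := by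
  obtain ⟨x, y, z, h0, h⟩ := h
  have hx := Rat.num_div_den x
  have hy := Rat.num_div_den y
  have hz := Rat.num_div_den z
  have dx := x.den_nz
  have dy := y.den_nz
  have dz := z.den_nz
  refine ⟨x.num * y.den * z.den, y.num * x.den * z.den, z.num * x.den * y.den, ?_, ?_⟩
  · simpa [dx, dy, dz] using h0
  · have : ((x.num * y.den * z.den : ℤ) : ℚ) ^ 2 = a * ((y.num * x.den * z.den : ℤ) : ℚ) ^ 2 +
        b * ((z.num * x.den * y.den : ℤ) : ℚ) ^ 2 := by
      rw [← hx, ← hy, ← hz] at h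
      push_cast
      field_simp at h
      linear_combination h
    exact_mod_cast this

/-- A solution of `Q(x, y) = z²` may be divided by the greatest common divisor of `x` and `y`. -/
theorem BinForm.exists_isCoprime_of_eval_eq_sq {Q : BinForm ℤ} {x y z : ℤ} (hz : z ≠ 0)
    (h : Q.eval x y = z ^ 2) : ∃ g x' y' z' : ℤ, x = g * x' ∧ y = g * y' ∧ z = g * z' ∧
      IsCoprime x' y' ∧ Q.eval x' y' = z' ^ 2 := by
  have hg : Int.gcd x y ≠ 0 := by
    intro hg
    obtain ⟨rfl, rfl⟩ := Int.gcd_eq_zero_iff.1 hg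
    simp only [eval] at h
    exact hz (pow_eq_zero_iff two_ne_zero |>.1 (by linear_combination -h))
  obtain ⟨x', y', hxy, hx, hy⟩ := Int.exists_gcd_one (Nat.pos_of_ne_zero hg)
  generalize hg' : (Int.gcd x y : ℤ) = g at hx hy
  have hg0 : g ≠ 0 := by rw [← hg']; exact_mod_cast hg
  have h1 : g ^ 2 * Q.eval x' y' = z ^ 2 := by
    rw [← h, hx, hy]; simp only [eval]; ring
  obtain ⟨z', rfl⟩ : g ∣ z := (Int.pow_dvd_pow_iff two_ne_zero).1 ⟨_, h1.symm⟩
  refine ⟨g, x', y', z', by rw [mul_comm]; exact hx, by rw [mul_comm]; exact hy, rfl,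
    Int.isCoprime_iff_gcd_eq_one.2 hxy, ?_⟩
  exact mul_left_cancel₀ (pow_ne_zero 2 hg0) (by rw [h1]; ring)

namespace BinForm

/-- The bilinear form `Q(v + w) - Q(v) - Q(w)`. -/
def polar {R : Type*} [CommRing R] (Q : BinForm R) (x y x' y' : R) : R :=
  2 * Q.l * x * x' + Q.m * (x * y' + y * x') + 2 * Q.r * y * y'

/-- A `p`-adic point of the conic `Q(x, y) = z²` with `z = 1` is approximated by integers which are
not close to the tangent line at a given integral point. -/
theorem exists_approx {Q : BinForm ℤ} {x₀ y₀ z₀ : ℤ} (hz : z₀ ≠ 0) (p : ℕ) [Fact p.Prime]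
    (h : (Q.map (Int.castRingHom ℤ_[p])).Represents 1) : ∃ (j : ℕ) (x y : ℤ),
      (p : ℤ) ^ (j + 1) ∣ Q.eval x y - 1 ∧ (p : ℤ) ^ j ∣ Q.polar x₀ y₀ x y - 2 * z₀ ∧
      ¬ (p : ℤ) ^ (j + 1) ∣ Q.polar x₀ y₀ x y - 2 * z₀ := by
  set Q' := Q.map (Int.castRingHom ℤ_[p]) with hQ'
  -- The points (x, y, 1) and (-x, -y, 1) cannot both lie on the tangent at (x₀, y₀, z₀): adding the
  -- two equations would give 4z₀ = 0.
  obtain ⟨x, y, hxy, hne⟩ : ∃ x y : ℤ_[p], Q'.eval x y = 1 ∧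
      Q'.polar x₀ y₀ x y - 2 * z₀ ≠ 0 := by
    obtain ⟨x, y, hxy⟩ := h
    by_contra! hcon
    have h1 := hcon x y hxy
    have h2 := hcon (-x) (-y) (by rw [← hxy]; simp only [eval]; ring)
    have h3 : (4 : ℤ_[p]) * z₀ = 0 := by
      simp only [polar] at h1 h2
      linear_combination -h1 - h2
    simp [hz] at h3
  obtain ⟨c, hc, hpc⟩ :=
    (FiniteMultiplicity.of_prime_left (PadicInt.prime_p (p := p)) hne).exists_eq_pow_mul_and_not_dvd
  generalize multiplicity (p : ℤ_[p]) (Q'.polar x₀ y₀ x y - 2 * z₀) = j at hc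
  -- Here j is the valuation of the tangent form at the p-adic point; precision j + 1 preserves it
  -- exactly.
  obtain ⟨a, u, hu⟩ := PadicInt.exists_int_pow_dvd_sub x (j + 1)
  obtain ⟨b, v, hv⟩ := PadicInt.exists_int_pow_dvd_sub y (j + 1)
  have key : (p : ℤ_[p]) ^ (j + 1) ∣ (Q'.polar x₀ y₀ x y - 2 * z₀) -
      ((Q.polar x₀ y₀ a b - 2 * z₀ : ℤ) : ℤ_[p]) := by
    refine ⟨Q'.polar x₀ y₀ u v, ?_⟩
    simp only [polar, hQ', map, eq_intCast]
    push_cast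
    linear_combination (2 * (Q.l : ℤ_[p]) * x₀ + Q.m * y₀) * hu + (Q.m * x₀ + 2 * Q.r * y₀) * hv
  refine ⟨j, a, b, ?_, ?_, fun hd => ?_⟩
  · rw [← PadicInt.pow_p_dvd_int_iff]
    refine ⟨-(Q.l * (x + a) * u + Q.m * (u * y + a * v) + Q.r * (y + b) * v), ?_⟩
    simp only [eval, hQ', map, eq_intCast] at hxy ⊢
    push_cast
    linear_combination hxy - (Q.l * (x + a) + Q.m * y) * hu - (Q.m * a + Q.r * (y + b)) * hv
  · rw [← PadicInt.pow_p_dvd_int_iff]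
    exact (dvd_sub_right (Dvd.intro _ hc.symm)).1 ((pow_dvd_pow _ j.le_succ).trans key)
  · rw [← PadicInt.pow_p_dvd_int_iff] at hd
    have h1 := (dvd_sub_left hd).1 key
    rw [hc, pow_succ] at h1
    exact hpc ((mul_dvd_mul_iff_left (pow_ne_zero j PadicInt.prime_p.ne_zero)).1 h1)

/-- Weak approximation on the conic `Q(x, y) = z²`. -/
theorem exists_isCoprime_eval_eq_sq {Q : BinForm ℤ} {x₀ y₀ z₀ n : ℤ} (hz : z₀ ≠ 0)
    (h₀ : Q.eval x₀ y₀ = z₀ ^ 2) (hn : n ≠ 0) (hn' : ¬ IsUnit n)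
    (h : ∀ (p : ℕ) [Fact p.Prime], (Q.map (Int.castRingHom ℤ_[p])).Represents 1) :
    ∃ x y z : ℤ, IsCoprime x y ∧ IsCoprime z n ∧ Q.eval x y = z ^ 2 := by
  have happ : ∀ p : ℕ, p.Prime → ∃ (j : ℕ) (x y : ℤ),
      (p : ℤ) ^ (j + 1) ∣ Q.eval x y - 1 ∧ (p : ℤ) ^ j ∣ Q.polar x₀ y₀ x y - 2 * z₀ ∧
      ¬ (p : ℤ) ^ (j + 1) ∣ Q.polar x₀ y₀ x y - 2 * z₀ := fun p hp => by
    have : Fact p.Prime := ⟨hp⟩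
    exact exists_approx hz p (h p)
  choose! j a b h1 h2 h3 using happ
  have hs : ∀ p ∈ n.natAbs.primeFactors, p.Prime := fun p hp => Nat.prime_of_mem_primeFactors hp
  obtain ⟨x, hx⟩ := Int.exists_forall_dvd_sub _ hs (fun p => j p + 1) a
  obtain ⟨y, hy⟩ := Int.exists_forall_dvd_sub _ hs (fun p => j p + 1) b
  -- With F = Q - z², f is the value of F at P = (x, y, 1), and β is its polar form between P and P₀
  -- = (x₀, y₀, z₀).
  set f := Q.eval x y - 1 with hf
  set β := Q.polar x₀ y₀ x y - 2 * z₀ with hβ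
  have hmem : ∀ p : ℕ, p.Prime → (p : ℤ) ∣ n → p ∈ n.natAbs.primeFactors := fun p hp hpn =>
    Nat.mem_primeFactors.2 ⟨hp, Int.natCast_dvd.1 hpn, Int.natAbs_ne_zero.2 hn⟩
  have hloc : ∀ p : ℕ, p.Prime → (p : ℤ) ∣ n →
      (p : ℤ) ^ (j p + 1) ∣ f ∧ (p : ℤ) ^ j p ∣ β ∧ ¬ (p : ℤ) ^ (j p + 1) ∣ β := by
    intro p hp hpn
    have hxp := hx p (hmem p hp hpn)
    have hyp := hy p (hmem p hp hpn)
    have e1 : (p : ℤ) ^ (j p + 1) ∣ f - (Q.eval (a p) (b p) - 1) := by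
      have := dvd_add (hxp.mul_right (Q.l * (x + a p) + Q.m * y))
        (hyp.mul_right (Q.m * a p + Q.r * (y + b p)))
      refine this.trans (dvd_of_eq ?_)
      simp only [hf, eval]; ring
    have e2 : (p : ℤ) ^ (j p + 1) ∣ β - (Q.polar x₀ y₀ (a p) (b p) - 2 * z₀) := by
      have := dvd_add (hxp.mul_right (2 * Q.l * x₀ + Q.m * y₀))
        (hyp.mul_right (Q.m * x₀ + 2 * Q.r * y₀))
      refine this.trans (dvd_of_eq ?_)
      simp only [hβ, polar]; ring
    refine ⟨(dvd_iff_dvd_of_dvd_sub e1).2 (h1 p hp), ?_, fun hd => h3 p hp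
      ((dvd_iff_dvd_of_dvd_sub e2).1 hd)⟩
    exact (dvd_iff_dvd_of_dvd_sub ((pow_dvd_pow _ (j p).le_succ).trans e2)).2 (h2 p hp)
  have hZ : ∀ p : ℕ, p.Prime → (p : ℤ) ∣ n → ¬ (p : ℤ) ^ (j p + 1) ∣ f * z₀ - β :=
    fun p hp hpn hd => by
      obtain ⟨hf', -, hβ'⟩ := hloc p hp hpn
      exact hβ' ((dvd_sub_right (hf'.mul_right z₀)).1 hd)
  -- A prime factor of n is needed here: its power p^(j+1) does not divide this integer.
  have hZ0 : f * z₀ - β ≠ 0 := by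
    obtain ⟨p, hp, hpn⟩ := Int.exists_prime_and_dvd fun h => hn' (Int.isUnit_iff_natAbs_eq.2 h)
    intro h0
    refine hZ p.natAbs (Int.prime_iff_natAbs_prime.1 hp) (Int.natAbs_dvd.2 hpn) ?_
    rw [h0]
    exact dvd_zero _
  -- The line through P₀ and P meets the conic again at fP₀ - βP.
  have hcurve : Q.eval (f * x₀ - β * x) (f * y₀ - β * y) = (f * z₀ - β) ^ 2 := by
    simp only [eval, polar] at h₀ hf hβ ⊢
    linear_combination f ^ 2 * h₀ - β ^ 2 * hf + f * β * hβ
  obtain ⟨g, x', y', z', e1, e2, e3, hco, hsq⟩ := exists_isCoprime_of_eval_eq_sq hZ0 hcurve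
  refine ⟨x', y', z', hco, Cl.isCoprime_of_primes fun p hp hpz hpn => ?_, hsq⟩
  obtain ⟨hf', hβ', -⟩ := hloc p hp hpn
  have hf'' := (pow_dvd_pow (p : ℤ) (j p).le_succ).trans hf'
  -- All coordinates are divisible by p^j and the last one by no higher power, so division by g
  -- leaves it prime to p.
  have hg : (p : ℤ) ^ j p ∣ g := by
    obtain ⟨u, v, huv⟩ := hco
    have := dvd_add ((dvd_sub (hf''.mul_right x₀) (hβ'.mul_right x)).mul_left u)
      ((dvd_sub (hf''.mul_right y₀) (hβ'.mul_right y)).mul_left v)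
    rwa [e1, e2, show u * (g * x') + v * (g * y') = g * (u * x' + v * y') by ring, huv,
      mul_one] at this
  apply hZ p hp hpn
  rw [e3, pow_succ]
  exact mul_dvd_mul hg hpz

end BinForm

/-! ### The principal genus consists of squares -/

namespace Cl

variable {Δ : ℤ}

theorem exists_l_eq_eval (Q : PrimForm Δ) {x y : ℤ} (h : IsCoprime x y) :
    ∃ Q' : PrimForm Δ, mk Q' = mk Q ∧ Q'.1.l = Q.1.eval x y := by
  obtain ⟨u, v, h⟩ := h
  exact ⟨move Q x (-v) y u (by linear_combination h), mk_move .., by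
    simp [move, BinForm.comp]⟩

/-- Completing the square: 4lQ(x, y) = (2lx + my)² - Δy². -/
theorem Represents.conicSolvable {F : Type*} [Field F] [CharZero F] {Q : PrimForm Δ}
    (h : Represents F (mk Q) 1) : ConicSolvable (Δ : F) Q.1.l := by
  obtain ⟨x, y, h⟩ := represents_mk_iff.1 h
  have hd := congrArg (Int.cast : ℤ → F) (disc_eq Q)
  push_cast at hd
  exact ⟨2 * Q.1.l * x + Q.1.m * y, y, 2, by simp,
    by linear_combination 4 * (Q.1.l : F) * h + y ^ 2 * hd⟩

/-- A form whose first coefficient is divisible by `p` and whose middle coefficient is not takes the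
value `1` over `ℤ_p`. -/
theorem represents_padicInt_one_of_dvd {p : ℕ} [hp : Fact p.Prime] {Q : PrimForm Δ}
    (hl : (p : ℤ) ∣ Q.1.l) (hm : ¬ (p : ℤ) ∣ Q.1.m) : Represents ℤ_[p] (mk Q) 1 := by
  obtain ⟨v, hv⟩ := (PadicInt.isUnit_intCast_iff.2 hm).exists_right_inv
  set l : ℤ_[p] := (Q.1.l : ℤ_[p]) with hl'
  set m : ℤ_[p] := (Q.1.m : ℤ_[p]) with hm'
  have hlp : (p : ℤ_[p]) ∣ l := PadicInt.dvd_intCast_iff.2 hl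
  -- F is Q(X, 1) - 1. Modulo p it is linear with unit slope m, so its root a lifts.
  set F : Polynomial ℤ_[p] := .C l * .X ^ 2 + .C m * .X + .C ((Q.1.r : ℤ_[p]) - 1) with hF
  set a := v * (1 - (Q.1.r : ℤ_[p])) with ha
  have h1 : F.aeval a = l * a ^ 2 := by
    simp only [hF, map_add, map_mul, Polynomial.aeval_C, map_pow, Polynomial.aeval_X,
      Algebra.algebraMap_self, RingHom.id_apply]
    linear_combination (1 - (Q.1.r : ℤ_[p])) * hv + m * ha
  have h2 : F.derivative.aeval a = l * (2 * a) + m := by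
    simp [hF, one_add_one_eq_two]
  have h3 : ‖F.derivative.aeval a‖ = 1 := by
    rw [h2, ← PadicInt.isUnit_iff]
    by_contra hcon
    rw [PadicInt.not_isUnit_iff, PadicInt.norm_lt_one_iff_dvd] at hcon
    exact hm (PadicInt.dvd_intCast_iff.1 ((dvd_add_right (hlp.mul_right _)).1 hcon))
  obtain ⟨z, hz, -⟩ := hensels_lemma (F := F) (a := a) (by
    rw [h3, one_pow, h1, PadicInt.norm_lt_one_iff_dvd]
    exact hlp.mul_right _)
  refine represents_mk_iff.2 ⟨z, 1, ?_⟩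
  simp only [hF, map_add, map_mul, Polynomial.aeval_C, map_pow, Polynomial.aeval_X,
      Algebra.algebraMap_self, RingHom.id_apply] at hz
  linear_combination hz

variable [NonsquareDisc Δ]

theorem disc_ne_zero (Δ : ℤ) [NonsquareDisc Δ] : Δ ≠ 0 := fun h =>
  NonsquareDisc.not_isSquare (Δ := Δ) ⟨0, by simpa using h⟩

theorem disc_not_isUnit (Δ : ℤ) [NonsquareDisc Δ] : ¬ IsUnit Δ := fun h => by
  rcases Int.isUnit_iff.1 h with h | h
  · exact NonsquareDisc.not_isSquare (Δ := Δ) ⟨1, by simpa using h⟩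
  · have := NonsquareDisc.mod_four (Δ := Δ)
    omega

/-- The inverse substitution: Q(x - my, 2ly) = l(x² - Δy²) = (lz)². A point with z = 0 would make Δ
a square. -/
theorem exists_eval_eq_sq {Q : PrimForm Δ} (h : ConicSolvable (Δ : ℚ) Q.1.l) :
    ∃ x y z : ℤ, z ≠ 0 ∧ Q.1.eval x y = z ^ 2 := by
  obtain ⟨x, y, z, h0, h⟩ := h.exists_int
  have hd := disc_eq Q
  refine ⟨x - Q.1.m * y, 2 * Q.1.l * y, Q.1.l * z, mul_ne_zero (l_ne_zero Q) fun hz => ?_, ?_⟩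
  · subst hz
    have hx : x ^ 2 = y ^ 2 * Δ := by linear_combination h
    obtain ⟨c, rfl⟩ : y ∣ x := (Int.pow_dvd_pow_iff two_ne_zero).1 ⟨_, hx⟩
    have hy : y ≠ 0 := by rintro rfl; simp at h0
    refine NonsquareDisc.not_isSquare (Δ := Δ) ⟨c, ?_⟩
    exact mul_left_cancel₀ (pow_ne_zero 2 hy) (by linear_combination -hx)
  · simp only [BinForm.eval]
    linear_combination Q.1.l * h - Q.1.l * y ^ 2 * hd

/-- A class which takes the value `d²`, where `d` is coprime to the discriminant, is a square. -/
theorem mem_squares_of_l_eq_sq {Q : PrimForm Δ} {d : ℤ} (hl : Q.1.l = d ^ 2)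
    (hd : IsCoprime d Δ) : mk Q ∈ squares Δ := by
  have hdm : IsCoprime d Q.1.m := isCoprime_of_primes fun p hp h1 h2 =>
    (Nat.prime_iff_prime_int.1 hp).not_isUnit <| hd.isUnit_of_dvd' h1 <| by
      rw [← disc_eq Q, hl]
      exact dvd_sub (h2.pow two_ne_zero) (((h1.pow two_ne_zero).mul_left 4).mul_right _)
  obtain ⟨u, v, huv⟩ := hdm
  -- As vm ≡ 1 modulo d, this shift makes the last coefficient ≡ 1 modulo d.
  obtain ⟨P, hP, hPl, hPm, hPr⟩ := exists_shift Q (v * (1 - Q.1.r))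
  rw [← hP]
  rw [hl] at hPl hPm hPr
  set t := v * (1 - Q.1.r) with ht
  have hdr : IsCoprime d P.1.r := by
    refine ⟨u * (1 - Q.1.r) - d * t ^ 2, 1, ?_⟩
    rw [hPr]
    linear_combination (1 - Q.1.r) * huv + Q.1.m * ht
  have hdm : IsCoprime d P.1.m := ⟨u - 2 * d * t * v, v, by rw [hPm]; linear_combination huv⟩
  have hdisc : P.1.m ^ 2 - 4 * d * (d * P.1.r) = Δ := by
    have := disc_eq P
    rw [hPl] at this
    linear_combination this
  let B : PrimForm Δ := ⟨⟨d, P.1.m, d * P.1.r⟩, hdisc, fun _ h1 h2 _ => hdm.isUnit_of_dvd' h1 h2⟩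
  obtain ⟨P', hP', hPl', hPm', -⟩ := mk_swap P
  obtain ⟨B', hB', hBl', hBm', -⟩ := mk_swap B
  -- `B` cannot be composed with itself directly, since d need not be coprime to d. Instead, (r, -m,
  -- d²) and (d, -m, dr) compose to (dr, -m, d), which says that the class of `P` times the inverse
  -- of that of `B` is that of `B`.
  have hcomp : IsComposition P' (opp B) B' := by
    refine ⟨?_, ?_, ?_, ?_⟩
    · rw [hPl']; exact hdr.symm
    · rw [hPm']; rfl
    · rw [hPl', hBl']; exact mul_comm _ _
    · rw [hPm', hBm']
  refine ⟨mk B, ?_⟩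
  rw [powMonoidHom_apply, pow_two]
  have h := mk_mul_mk hcomp
  rw [hP', hB', ← inv_mk] at h
  exact (mul_inv_eq_iff_eq_mul.1 h).symm

/-- The local values 1 serve twice: over ℚ_p for the Hasse principle, then over ℤ_p to make d
coprime to Δ. -/
theorem principalGenus_le_squares : principalGenus Δ ≤ squares Δ := by
  intro A hA
  obtain ⟨Q, rfl⟩ := exists_mk A
  obtain ⟨hreal, hp⟩ := mem_principalGenus.1 hA
  have hloc : LocallySolvable Δ Q.1.l := ⟨hreal.conicSolvable, fun p _ => by
    have := (hp p).map PadicInt.Coe.ringHom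
    rw [map_one] at this
    exact this.conicSolvable⟩
  obtain ⟨x₀, y₀, z₀, hz, h₀⟩ :=
    exists_eval_eq_sq (hloc.conicSolvable (disc_ne_zero Δ) (l_ne_zero Q))
  obtain ⟨x, y, d, hxy, hd, h⟩ := BinForm.exists_isCoprime_eval_eq_sq hz h₀ (disc_ne_zero Δ)
    (disc_not_isUnit Δ) fun p _ => represents_mk.1 (hp p)
  obtain ⟨Q', hQ', hl⟩ := exists_l_eq_eval Q hxy
  rw [← hQ']
  exact mem_squares_of_l_eq_sq (hl.trans h) hd

theorem principalGenus_eq_squares : principalGenus Δ = squares Δ :=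
  le_antisymm principalGenus_le_squares squares_le_principalGenus

/-! ### Fundamental discriminants -/

/-- Otherwise (l/p², m/p, r) would have discriminant Δ/p². The delicate case is Δ = 4D with p = 2:
then D = (m/2)² - lr is divisible by 4 or ≡ 1 modulo 4. -/
theorem _root_.IsFundamentalDisc.not_dvd_m (h : IsFundamentalDisc Δ) {Q : PrimForm Δ} {p : ℕ}
    (hp : p.Prime) (hl : (p : ℤ) ^ 2 ∣ Q.1.l) : ¬ (p : ℤ) ∣ Q.1.m := by
  rintro ⟨m, hm⟩
  obtain ⟨l, hl⟩ := hl
  have hd := disc_eq Q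
  rw [hm, hl] at hd
  have hpi := Nat.prime_iff_prime_int.1 hp
  have hsq : (p : ℤ) * p ∣ Δ := ⟨m ^ 2 - 4 * l * Q.1.r, by linear_combination -hd⟩
  obtain ⟨-, ⟨-, h⟩ | ⟨h4, h1, h⟩⟩ := h
  · exact hpi.not_isUnit (h _ hsq)
  · obtain ⟨D, rfl⟩ := Int.dvd_of_emod_eq_zero h4
    rw [Int.mul_ediv_cancel_left _ four_ne_zero] at h h1
    by_cases hp2 : p = 2
    · subst hp2
      have hD : D = m ^ 2 - 4 * (l * Q.1.r) := by
        push_cast at hd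
        linarith
      rcases Int.even_or_odd' m with ⟨k, rfl | rfl⟩
      · refine hpi.not_isUnit (h _ ⟨k ^ 2 - l * Q.1.r, ?_⟩)
        push_cast
        linear_combination hD
      · apply h1
        rw [hD]
        ring_nf
        omega
    · refine hpi.not_isUnit (h _ ?_)
      have hco : IsCoprime ((p : ℤ) * p) 4 := by
        have : IsCoprime (p : ℤ) 2 := Nat.isCoprime_iff_coprime.2
          ((Nat.coprime_primes hp Nat.prime_two).2 hp2)
        rw [← pow_two, show (4 : ℤ) = 2 ^ 2 by norm_num]
        exact this.pow
      exact hco.dvd_of_dvd_mul_left hsq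

/-- The rational value 1 yields a first coefficient d²: a unit square if p does not divide d,
otherwise divisible by p², where `IsFundamentalDisc.not_dvd_m` opens the way to Hensel's lemma. -/
theorem represents_padicInt_one (h : IsFundamentalDisc Δ) {A : Cl Δ} (hA : Represents ℚ A 1)
    (p : ℕ) [hp : Fact p.Prime] : Represents ℤ_[p] A 1 := by
  obtain ⟨Q, rfl⟩ := exists_mk A
  obtain ⟨x₀, y₀, z₀, hz, h₀⟩ := exists_eval_eq_sq hA.conicSolvable
  obtain ⟨g, x, y, d, -, -, -, hxy, hd⟩ := BinForm.exists_isCoprime_of_eval_eq_sq hz h₀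
  obtain ⟨Q', hQ', hl⟩ := exists_l_eq_eval Q hxy
  rw [← hQ']
  rw [hd] at hl
  by_cases hpd : (p : ℤ) ∣ d
  · have hpl : (p : ℤ) ^ 2 ∣ Q'.1.l := hl ▸ pow_dvd_pow_of_dvd hpd 2
    exact represents_padicInt_one_of_dvd ((dvd_pow_self _ two_ne_zero).trans hpl)
      (h.not_dvd_m hp.1 hpl)
  · refine Represents.one_of_sq (PadicInt.isUnit_intCast_iff.2 hpd) ?_
    have := represents_l (R := ℤ_[p]) Q'
    rwa [hl, Int.cast_pow, pow_two] at this

theorem representingOne_rat_le_principalGenus (h : IsFundamentalDisc Δ) :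
    representingOne Δ ℚ ≤ principalGenus Δ := fun _ hA => mem_principalGenus.2
  ⟨by simpa using Represents.map (algebraMap ℚ ℝ) (mem_representingOne.1 hA),
    fun p _ => represents_padicInt_one h hA p⟩

/-! ### A non-fundamental counterexample, and the theorem -/

/-- For discriminant `-36`, the form `2 x² + 2 x y + 5 y²` is `ℚ`-equivalent to the principal form
but is not in the principal genus. -/
theorem exists_qEquiv_not_sameGenus : ∃ Δ : ℤ, NonsquareDisc Δ ∧ ¬ IsFundamentalDisc Δ ∧
    ∃ A B : Cl Δ, QEquiv A B ∧ ¬ SameGenus A B := by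
  have hns : NonsquareDisc (-36) :=
    ⟨fun ⟨a, ha⟩ => by nlinarith [mul_self_nonneg a], by norm_num⟩
  let Q : PrimForm (-36) := ⟨⟨2, 2, 5⟩, by simp [BinForm.disc], fun d h1 _ h3 =>
    isUnit_of_dvd_one (by simpa using dvd_sub h3 (h1.mul_left 2))⟩
  refine ⟨-36, hns, ?_, mk Q, 1, ?_, ?_⟩
  · rintro ⟨-, ⟨h, -⟩ | ⟨-, -, h⟩⟩
    · norm_num at h
    · have := h 3 (by norm_num)
      norm_num [Int.isUnit_iff] at this
  · rw [qEquiv_iff, inv_one, mul_one]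
    -- From Q(2, -1) = 9 = 3².
    exact represents_mk_iff.2 ⟨2 / 3, -1 / 3, by norm_num [Q]⟩
  · rw [sameGenus_iff, inv_one, mul_one, mem_principalGenus]
    rintro ⟨-, h⟩
    -- Modulo 3 the form is 2(x - y)², which misses 1.
    have key : ∀ x y : ZMod 3, ¬ 2 * x ^ 2 + 2 * x * y + 5 * y ^ 2 = 1 := by decide
    have : Fact (Nat.Prime 3) := ⟨Nat.prime_three⟩
    obtain ⟨x, y, h⟩ := represents_mk_iff.1 ((h 3).map (PadicInt.toZMod (p := 3)))
    exact key x y (by simpa [Q] using h)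

end Cl

theorem mainTheorem5 :
    (∀ (Δ : ℤ) [NonsquareDisc Δ],
      ({A : Cl Δ | Cl.SameGenus A 1} = (Cl.squares Δ : Set (Cl Δ))) ∧
      (∃ H : Subgroup (Cl Δ), (H : Set (Cl Δ)) = {A : Cl Δ | Cl.QEquiv A 1} ∧
        Cl.squares Δ ≤ H) ∧
      (∀ A B : Cl Δ, Cl.SameGenus A B → Cl.QEquiv A B) ∧
      (IsFundamentalDisc Δ → ∀ A B : Cl Δ, Cl.QEquiv A B → Cl.SameGenus A B)) ∧
    (∃ Δ : ℤ, NonsquareDisc Δ ∧ ¬ IsFundamentalDisc Δ ∧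
      ∃ A B : Cl Δ, Cl.QEquiv A B ∧ ¬ Cl.SameGenus A B) := by
  refine ⟨fun Δ _ => ?_, Cl.exists_qEquiv_not_sameGenus⟩
  have hle : Cl.squares Δ ≤ Cl.representingOne Δ ℚ :=
    Cl.squares_le_representingOne (Cl.exists_isUnit_represents_of_field ℚ)
  refine ⟨?_, ⟨Cl.representingOne Δ ℚ, ?_, hle⟩, fun A B h => ?_, fun h A B hAB => ?_⟩
  · ext A
    rw [← Cl.principalGenus_eq_squares, Set.mem_ofPred_eq, Cl.sameGenus_iff, inv_one, mul_one,
      SetLike.mem_coe]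
  · ext A
    rw [Set.mem_ofPred_eq, Cl.qEquiv_iff, inv_one, mul_one, SetLike.mem_coe]
  · rw [Cl.sameGenus_iff, Cl.principalGenus_eq_squares] at h
    exact Cl.qEquiv_iff.2 (hle h)
  · exact Cl.sameGenus_iff.2 (Cl.representingOne_rat_le_principalGenus h (Cl.qEquiv_iff.1 hAB))
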